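/- Let $A$ be a unital $C^*$-algebra and $\alpha$ an injective unital $*$-endomorphism of $A$; $\mathbb N=\{0,1,2,\dots\}$, and representations are unital. A covariant representation $(\mathcal H,\pi,W)$ of $(A,\alpha)$ consists of a representation $\pi$ of $A$ on a Hilbert space $\mathcal H$ and an isometry $W\in\mathcal B(\mathcal H)$ with $\pi(\alpha(a))W=W\pi(a)$ for all $a\in A$ and $W^kW^{*k}\in\pi(A)'$ for all $k\in\mathbb N$. A crossed product of $A$ with $\mathbb N$ by $\alpha$ is a unital $C^*$-algebra $\mathcal B$ together with a unital injective $*$-homomorphism $\iota_A:A\to\mathcal B$ and an isometry $t\in\mathcal B$ such that (1) $\mathcal B$ is the $C^*$-algebra generated by $\iota_A(A)$ and $t$; (2) $\iota_A(\alpha(a))t=t\,\iota_A(a)$ for $a\in A$; (3) $t^k(t^*)^k$ commutes with $\iota_A(A)$ for $k\in\mathbb N$; (4) for every covariant representation $(\mathcal H,\pi,W)$ of $(A,\alpha)$ there is a non-degenerate representation $\widehat\pi$ of $\mathcal B$ on $\mathcal H$ with $\widehat\pi\circ\iota_A=\pi$ and $\widehat\pi(t)=W$. Let $A_\infty$ be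 the inductive limit $C^*$-algebra of $A\xrightarrow{\alpha}A\xrightarrow{\alpha}A\to\cdots$, with canonical maps $\varphi_{\infty n}:A\to A_\infty$, and let $\alpha_\infty$ be the automorphism of $A_\infty$ with $\alpha_\infty\circ\varphi_{\infty n}=\varphi_{\infty n}\circ\alpha$. Let $\pi_u$ be the universal representation of $A_\infty$ (the direct sum of the GNS representations of all states), on $\mathcal H_u$. On $\ell^2(\mathbb Z,\mathcal H_u)$ put $(U\xi)(n)=\xi(n-1)$ and $(\widetilde{\pi_u}(x)\xi)(n)=\pi_u(\alpha_\infty^{-n}(x))\xi(n)$, let $p$ be the projection with $(p\xi)(n)=\xi(n)$ for $n\ge 0$ and $(p\xi)(n)=0$ for $n<0$, and let $A_\infty\rtimes_{\alpha_\infty}\mathbb Z$ be the $C^*$-algebra generated by $\widetilde{\pi_u}(A_\infty)$ and $U$. On $p\,\ell^2(\mathbb Z,\mathcal H_u)$ put $\iota_A(a)=\widetilde{\pi_u}(\varphi_{\infty 0}(a))p$ and $t=pUp$, and let $C^*(A,\alpha,\mathbb N)$ be the $C^*$-algebra generated by $\iota_A(A)$ and $t$. Then $t=Up$, and $C^*(A,\alpha,\mathbb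 N)$, with $\iota_A$ and $t$, is a crossed product of $A$ with $\mathbb N$ by $\alpha$; in particular every covariant representation of $(A,\alpha)$ extends to a representation of it. Moreover, $C^*(A,\alpha,\mathbb N)$ is the $C^*$-algebra generated by the compression $p(A_\infty\rtimes_{\alpha_\infty}\mathbb Z)p$. -/

import Mathlib

universe u v w

set_option linter.unusedSectionVars false

noncomputable section

namespace CStarCrossedProduct

open UniformSpace

/-! ### Completion of a pre-C*-algebra -/

section Completion

variable (P : Type*) [NormedRing P] [NormedAlgebra ℂ P] [StarRing P] [StarModule ℂ P]
  [CStarRing P]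

/-- The involution on the completion is the continuous extension of the given one. -/
instance completionStar : Star (Completion P) where
  star := Completion.map star

variable {P}

lemma star_coe (a : P) : star (a : Completion P) = ((star a : P) : Completion P) :=
  Completion.map_coe (starₗᵢ ℂ : P ≃ₗᵢ⋆[ℂ] P).isometry.uniformContinuous a

lemma continuous_completionStar : Continuous (star : Completion P → Completion P) :=
  Completion.continuous_map

variable (P)

instance completionStarRing : StarRing (Completion P) where
  star_involutive x := by
    have hc := continuous_completionStar (P := P)
    induction x using Completion.induction_on with
    | hp => exact isClosed_eq (hc.comp hc) continuous_id
    | ih a => rw [star_coe, star_coe, star_star]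
  star_mul x y := by
    have hc := continuous_completionStar (P := P)
    induction x, y using Completion.induction_on₂ with
    | hp => apply isClosed_eq <;> fun_prop
    | ih a b => rw [← Completion.coe_mul, star_coe, star_coe, star_coe, star_mul,
        Completion.coe_mul]
  star_add x y := by
    have hc := continuous_completionStar (P := P)
    induction x, y using Completion.induction_on₂ with
    | hp => apply isClosed_eq <;> fun_prop
    | ih a b => rw [← Completion.coe_add, star_coe, star_coe, star_coe, star_add,
        Completion.coe_add]

instance completionNormedAlgebra : NormedAlgebra ℂ (Completion P) where
  norm_smul_le c x := norm_smul_le c x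

instance completionCStarRing : CStarRing (Completion P) where
  norm_mul_self_le x := by
    have hc := continuous_completionStar (P := P)
    induction x using Completion.induction_on with
    | hp => apply isClosed_le <;> fun_prop
    | ih a => rw [star_coe, ← Completion.coe_mul, Completion.norm_coe,
        Completion.norm_coe, CStarRing.norm_star_mul_self]

instance completionStarModule : StarModule ℂ (Completion P) where
  star_smul c x := by
    rw [Algebra.smul_def, Algebra.smul_def, star_mul, Completion.algebraMap_def,
      Completion.algebraMap_def, star_coe, ← algebraMap_star_comm, ← Completion.algebraMap_def]
    exact (Algebra.commutes _ _).symm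

/-- The completion of a complex `*`-algebra for a C*-norm is a C*-algebra. -/
instance completionCStarAlgebra : CStarAlgebra (Completion P) where

variable {P}

/-- The dense inclusion of a pre-C*-algebra in its completion. -/
def toCompletion : P →⋆ₐ[ℂ] Completion P where
  toFun a := (a : Completion P)
  map_one' := Completion.coe_one P
  map_mul' := Completion.coe_mul
  map_zero' := Completion.coe_zero
  map_add' := Completion.coe_add
  commutes' c := by rw [Completion.algebraMap_def]
  map_star' a := (star_coe a).symm

/-- The continuous extension to the completions of an isometric `*`-homomorphism. -/
def completionMap (f : P →⋆ₐ[ℂ] P) (hf : Isometry f) : Completion P →⋆ₐ[ℂ] Completion P where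
  __ := Completion.mapRingHom (f : P →+* P) hf.continuous
  commutes' c := by
    change Completion.map f (algebraMap ℂ (Completion P) c) = _
    rw [Completion.algebraMap_def, Completion.map_coe hf.uniformContinuous, AlgHomClass.commutes]
  map_star' x := by
    change Completion.map f (star x) = star (Completion.map f x)
    have hc : Continuous (Completion.map f) := Completion.continuous_map
    induction x using Completion.induction_on with
    | hp => apply isClosed_eq <;> fun_prop
    | ih a => rw [star_coe, Completion.map_coe hf.uniformContinuous,
        Completion.map_coe hf.uniformContinuous, star_coe, map_star]

lemma completionMap_coe (f : P →⋆ₐ[ℂ] P) (hf : Isometry f) (a : P) :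
    completionMap f hf (a : Completion P) = ((f a : P) : Completion P) :=
  Completion.map_coe hf.uniformContinuous a

end Completion

/-! ### The inductive limit of `A → A → A → ⋯` with all connecting maps equal to `α` -/

section InductiveLimit

variable {A : Type u} [CStarAlgebra A]

/-- The connecting map `α ^ (n - m) : A_m → A_n`, for `m ≤ n`. -/
def connecting (α : A →⋆ₐ[ℂ] A) (m n : ℕ) (_ : m ≤ n) : A →⋆ₐ[ℂ] A := α ^ (n - m)

lemma connecting_succ (α : A →⋆ₐ[ℂ] A) (n : ℕ) (a : A) :
    connecting α n (n + 1) n.le_succ a = α a := by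
  simp [connecting]

instance connecting_directedSystem (α : A →⋆ₐ[ℂ] A) :
    DirectedSystem (fun _ : ℕ => A) (connecting α · · ·) where
  map_self i x := by simp only [connecting, Nat.sub_self, pow_zero]; rfl
  map_map {k j i} hij hjk x := by
    have h : k - i = (k - j) + (j - i) := by omega
    simp only [connecting, h, pow_add]
    rfl

lemma isometry_connecting (α : A →⋆ₐ[ℂ] A) (hα : Function.Injective α) (m n : ℕ) (h : m ≤ n) :
    Isometry (connecting α m n h) := by
  apply NonUnitalStarAlgHom.isometry
  have : ∀ k : ℕ, Function.Injective (α ^ k) := by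
    intro k
    induction k with
    | zero => exact fun _ _ h => h
    | succ k ih => rw [pow_succ]; exact ih.comp hα
  exact this _

/-- The algebraic inductive limit of `A → A → A → ⋯`. -/
def PreLimit (α : A →⋆ₐ[ℂ] A) (_ : Function.Injective α) : Type u :=
  DirectLimit (fun _ : ℕ => A) (connecting α)

namespace PreLimit

variable (α : A →⋆ₐ[ℂ] A) (hα : Function.Injective α)

instance : Ring (PreLimit α hα) :=
  inferInstanceAs (Ring (DirectLimit (fun _ : ℕ => A) (connecting α)))

instance : Algebra ℂ (PreLimit α hα) :=
  inferInstanceAs (Algebra ℂ (DirectLimit (fun _ : ℕ => A) (connecting α)))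

/-- The class in the limit of an element `a` of the `n`-th copy of `A`. -/
def mk (n : ℕ) (a : A) : PreLimit α hα :=
  (⟦⟨n, a⟩⟧ : DirectLimit (fun _ : ℕ => A) (connecting α))

variable {α hα}

lemma induction {C : PreLimit α hα → Prop} (h : ∀ n a, C (mk α hα n a)) (x) : C x :=
  DirectLimit.induction _ h x

lemma induction₂ {C : PreLimit α hα → PreLimit α hα → Prop}
    (h : ∀ n a b, C (mk α hα n a) (mk α hα n b)) (x y) : C x y :=
  DirectLimit.induction₂ _ h x y

lemma mk_mul (n : ℕ) (a b : A) : mk α hα n (a * b) = mk α hα n a * mk α hα n b :=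
  (DirectLimit.mul_def ..).symm

lemma mk_add (n : ℕ) (a b : A) : mk α hα n (a + b) = mk α hα n a + mk α hα n b :=
  (DirectLimit.add_def ..).symm

lemma mk_sub (n : ℕ) (a b : A) : mk α hα n (a - b) = mk α hα n a - mk α hα n b :=
  (DirectLimit.sub_def ..).symm

lemma mk_one (n : ℕ) : mk α hα n 1 = 1 :=
  (DirectLimit.one_def ..).symm

lemma mk_zero (n : ℕ) : mk α hα n 0 = 0 :=
  (DirectLimit.zero_def ..).symm

lemma mk_smul (n : ℕ) (c : ℂ) (a : A) : mk α hα n (c • a) = c • mk α hα n a :=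
  (DirectLimit.smul_def ..).symm

lemma mk_succ (n : ℕ) (a : A) : mk α hα (n + 1) (α a) = mk α hα n a := by
  rw [← connecting_succ α n a]
  exact DirectLimit.mk_apply (f := connecting α) n (n + 1) a n.le_succ

instance : StarRing (PreLimit α hα) where
  star := DirectLimit.map (connecting α) (connecting α) (fun _ a => star a)
    (fun m n h a => map_star (connecting α m n h) a)
  star_involutive := induction fun n a => congrArg (mk α hα n) (star_star a)
  star_mul := induction₂ fun n a b => by
    rw [← mk_mul]
    refine (congrArg (mk α hα n) (star_mul a b)).trans (mk_mul ..)
  star_add := induction₂ fun n a b => by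
    rw [← mk_add]
    refine (congrArg (mk α hα n) (star_add a b)).trans (mk_add ..)

lemma mk_star (n : ℕ) (a : A) : mk α hα n (star a) = star (mk α hα n a) := rfl

instance : Norm (PreLimit α hα) where
  norm := DirectLimit.lift (connecting α) (fun _ a => ‖a‖)
    (fun m n h a => ((isometry_connecting α hα m n h).norm_map_of_map_zero (map_zero _) a).symm)

lemma norm_mk (n : ℕ) (a : A) : ‖mk α hα n a‖ = ‖a‖ := rfl

instance : NormedRing (PreLimit α hα) where
  __ : Ring (PreLimit α hα) := inferInstance
  __ : NormedAddCommGroup (PreLimit α hα) := NormedAddCommGroup.ofCore (𝕜 := ℂ)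
    { norm_nonneg := induction fun n a => norm_nonneg a
      norm_smul := fun c => induction fun n a => by rw [← mk_smul, norm_mk, norm_mk, norm_smul]
      norm_triangle := induction₂ fun n a b => by
        rw [← mk_add]; simp only [norm_mk]; exact norm_add_le a b
      norm_eq_zero_iff := induction fun n a => by
        rw [norm_mk, norm_eq_zero]
        refine ⟨fun h => by rw [h, mk_zero], fun h => ?_⟩
        rw [← norm_eq_zero, ← norm_mk (α := α) (hα := hα) n a, h, ← mk_zero 0, norm_mk, norm_zero] }
  norm_mul_le := induction₂ fun n a b => by
    rw [← mk_mul]; simp only [norm_mk]; exact norm_mul_le a b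

instance : NormedAlgebra ℂ (PreLimit α hα) where
  norm_smul_le c := induction fun n a => by rw [← mk_smul, norm_mk, norm_mk, norm_smul]

instance : StarModule ℂ (PreLimit α hα) where
  star_smul c := induction fun n a => by
    rw [← mk_smul, ← mk_star, ← mk_star, ← mk_smul, star_smul]

instance : CStarRing (PreLimit α hα) where
  norm_mul_self_le := induction fun n a => by
    rw [← mk_star, ← mk_mul, norm_mk, norm_mk, CStarRing.norm_star_mul_self]

variable (α hα)

/-- The canonical map of the `n`-th copy of `A` to the algebraic inductive limit. -/
def ofLevel (n : ℕ) : A →⋆ₐ[ℂ] PreLimit α hα where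
  toFun := mk α hα n
  map_one' := mk_one n
  map_mul' := mk_mul n
  map_zero' := mk_zero n
  map_add' := mk_add n
  commutes' c := by rw [Algebra.algebraMap_eq_smul_one, mk_smul, mk_one,
    Algebra.algebraMap_eq_smul_one]
  map_star' := mk_star n

/-- The endomorphism of the algebraic inductive limit that is `α` on each copy of `A`. -/
def forward : PreLimit α hα →⋆ₐ[ℂ] PreLimit α hα where
  toFun := DirectLimit.map (connecting α) (connecting α) (fun _ a => α a)
    (fun m n h a => by
      change (α ^ (n - m) * α) a = (α * α ^ (n - m)) a
      rw [← pow_succ, ← pow_succ'])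
  map_one' := by
    rw [← mk_one 0]; exact congrArg (mk α hα 0) (map_one α)
  map_mul' := induction₂ fun n a b => by
    rw [← mk_mul]; exact (congrArg (mk α hα n) (map_mul α a b)).trans (mk_mul ..)
  map_zero' := by
    rw [← mk_zero 0]; exact congrArg (mk α hα 0) (map_zero α)
  map_add' := induction₂ fun n a b => by
    rw [← mk_add]; exact (congrArg (mk α hα n) (map_add α a b)).trans (mk_add ..)
  commutes' c := by
    rw [Algebra.algebraMap_eq_smul_one, ← mk_one 0, ← mk_smul]
    exact congrArg (mk α hα 0) (show α (c • 1) = c • 1 by rw [map_smul, map_one])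
  map_star' := induction fun n a => by
    rw [← mk_star]; exact congrArg (mk α hα n) (map_star α a)

lemma forward_mk (n : ℕ) (a : A) : forward α hα (mk α hα n a) = mk α hα n (α a) := rfl

/-- The endomorphism of the algebraic inductive limit that maps the `n`-th copy of `A` identically
to the `n + 1`-st one. -/
def backward : PreLimit α hα →⋆ₐ[ℂ] PreLimit α hα where
  toFun := DirectLimit.lift (connecting α) (fun n a => mk α hα (n + 1) a)
    (fun m n h a => by
      have h' : connecting α (m + 1) (n + 1) (by omega) a = connecting α m n h a := by
        simp [connecting]
      rw [← h']
      exact (DirectLimit.mk_apply (f := connecting α) (m + 1) (n + 1) a (by omega)).symm)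
  map_one' := by
    rw [← mk_one 0]; exact (mk_one 1).trans (mk_one 0).symm
  map_mul' := induction₂ fun n a b => by
    rw [← mk_mul]; exact mk_mul (n + 1) a b
  map_zero' := by
    rw [← mk_zero 0]; exact (mk_zero 1).trans (mk_zero 0).symm
  map_add' := induction₂ fun n a b => by
    rw [← mk_add]; exact mk_add (n + 1) a b
  commutes' c := by
    rw [Algebra.algebraMap_eq_smul_one, ← mk_one 0, ← mk_smul]
    exact (mk_smul 1 c 1).trans (by rw [mk_one, mk_smul, mk_one])
  map_star' := induction fun n a => mk_star (n + 1) a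

lemma backward_mk (n : ℕ) (a : A) : backward α hα (mk α hα n a) = mk α hα (n + 1) a := rfl

lemma isometry_forward : Isometry (forward α hα) :=
  AddMonoidHomClass.isometry_of_norm _ <| induction fun n a => by
    rw [forward_mk, norm_mk, norm_mk, NonUnitalStarAlgHom.norm_map α hα]

lemma isometry_backward : Isometry (backward α hα) :=
  AddMonoidHomClass.isometry_of_norm _ <| induction fun n a => by
    rw [backward_mk, norm_mk, norm_mk]

end PreLimit

/-- The inductive limit C*-algebra `A_∞` of `A → A → A → ⋯`, all connecting maps being `α`. -/
abbrev Limit (α : A →⋆ₐ[ℂ] A) (hα : Function.Injective α) : Type u := Completion (PreLimit α hα)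

variable (α : A →⋆ₐ[ℂ] A) (hα : Function.Injective α)

/-- The canonical map `φ_{∞ n} : A_n → A_∞`. -/
def limitMap (n : ℕ) : A →⋆ₐ[ℂ] Limit α hα := toCompletion.comp (PreLimit.ofLevel α hα n)

/-- The automorphism `α_∞` of `A_∞`, determined by `α_∞ (φ_{∞ n} a) = φ_{∞ n} (α a)`. Its inverse
is determined by `φ_{∞ n} a ↦ φ_{∞ (n + 1)} a`. -/
def limitAut : Limit α hα ≃⋆ₐ[ℂ] Limit α hα :=
  StarAlgEquiv.ofStarAlgHom
    (completionMap (PreLimit.forward α hα) (PreLimit.isometry_forward α hα))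
    (completionMap (PreLimit.backward α hα) (PreLimit.isometry_backward α hα))
    (by
      ext x
      change Completion.map _ (Completion.map _ x) = x
      induction x using Completion.induction_on with
      | hp =>
          exact isClosed_eq (Completion.continuous_map.comp Completion.continuous_map) continuous_id
      | ih a =>
        refine (congrArg _ (completionMap_coe _ (PreLimit.isometry_forward α hα) a)).trans ?_
        refine (completionMap_coe _ (PreLimit.isometry_backward α hα) _).trans ?_
        congr 1
        induction a using PreLimit.induction with
        | h n a => exact PreLimit.mk_succ n a)
    (by
      ext x
      change Completion.map _ (Completion.map _ x) = x
      induction x using Completion.induction_on with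
      | hp =>
          exact isClosed_eq (Completion.continuous_map.comp Completion.continuous_map) continuous_id
      | ih a =>
        refine (congrArg _ (completionMap_coe _ (PreLimit.isometry_backward α hα) a)).trans ?_
        refine (completionMap_coe _ (PreLimit.isometry_forward α hα) _).trans ?_
        congr 1
        induction a using PreLimit.induction with
        | h n a => exact PreLimit.mk_succ n a)

lemma limitMap_succ (n : ℕ) (a : A) : limitMap α hα (n + 1) (α a) = limitMap α hα n a :=
  congrArg ((↑) : PreLimit α hα → Limit α hα) (PreLimit.mk_succ n a)

lemma limitAut_limitMap (n : ℕ) (a : A) :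
    limitAut α hα (limitMap α hα n a) = limitMap α hα n (α a) :=
  completionMap_coe _ (PreLimit.isometry_forward α hα) (PreLimit.mk α hα n a)

end InductiveLimit

/-! ### Direct sums of representations and the universal representation -/

section Representations

variable {B : Type u} [CStarAlgebra B]

/-- The direct sum of a family of representations, on the Hilbert space direct sum. -/
def directSum {ι : Type v} {H : ι → Type w} [∀ i, NormedAddCommGroup (H i)]
    [∀ i, InnerProductSpace ℂ (H i)] [∀ i, CompleteSpace (H i)]
    (π : ∀ i, B →⋆ₐ[ℂ] (H i →L[ℂ] H i)) : B →⋆ₐ[ℂ] (lp H 2 →L[ℂ] lp H 2) where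
  toFun b := lp.mapCLM 2 (fun i => π i b) (norm_nonneg b)
    (fun i => NonUnitalStarAlgHom.norm_apply_le (π i) b)
  map_one' := by ext; simp
  map_mul' _ _ := by ext; simp
  map_zero' := by ext; simp
  map_add' _ _ := by ext; simp
  commutes' c := by ext; simp [Algebra.algebraMap_eq_smul_one]
  map_star' b := by
    refine (ContinuousLinearMap.eq_adjoint_iff _ _).mpr fun ξ η => ?_
    simp only [lp.inner_eq_tsum]
    refine tsum_congr fun i => ?_
    simp [map_star, ContinuousLinearMap.star_eq_adjoint, ContinuousLinearMap.adjoint_inner_left]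

lemma directSum_apply {ι : Type v} {H : ι → Type w} [∀ i, NormedAddCommGroup (H i)]
    [∀ i, InnerProductSpace ℂ (H i)] [∀ i, CompleteSpace (H i)]
    (π : ∀ i, B →⋆ₐ[ℂ] (H i →L[ℂ] H i)) (b : B) (ξ : lp H 2) (i : ι) :
    directSum π b ξ i = π i b (ξ i) := rfl

attribute [local instance] CStarAlgebra.spectralOrder CStarAlgebra.spectralOrderedRing

open scoped ComplexOrder in
variable (B) in
/-- The states of a unital C*-algebra: the positive linear functionals with value `1` at `1`. -/
def State : Type u := {f : B →ₚ[ℂ] ℂ // f 1 = 1}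

open scoped ComplexOrder in
variable (B) in
/-- The Hilbert space `H_u` of the universal representation: the direct sum of the Hilbert spaces
of the GNS representations of all states. -/
def UniversalSpace : Type u := lp (fun f : State B => f.1.GNS) 2

open scoped ComplexOrder in
instance : NormedAddCommGroup (UniversalSpace B) :=
  inferInstanceAs (NormedAddCommGroup (lp (fun f : State B => f.1.GNS) 2))

open scoped ComplexOrder in
instance : InnerProductSpace ℂ (UniversalSpace B) :=
  inferInstanceAs (InnerProductSpace ℂ (lp (fun f : State B => f.1.GNS) 2))

open scoped ComplexOrder in
instance : CompleteSpace (UniversalSpace B) :=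
  inferInstanceAs (CompleteSpace (lp (fun f : State B => f.1.GNS) 2))

open scoped ComplexOrder in
variable (B) in
/-- The universal representation `π_u`: the direct sum of the GNS representations of all states. -/
def universalRep : B →⋆ₐ[ℂ] (UniversalSpace B →L[ℂ] UniversalSpace B) :=
  directSum fun f : State B => f.1.gnsStarAlgHom

end Representations

/-! ### The crossed product by an automorphism, in its regular representation -/

section CrossedProduct

/-- The Hilbert space `ℓ²(ℤ, H)`. -/
abbrev L2Z (H : Type w) [NormedAddCommGroup H] : Type w := lp (fun _ : ℤ => H) 2

section Space

variable (H : Type w) [NormedAddCommGroup H] [InnerProductSpace ℂ H] [CompleteSpace H]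

/-- The bilateral shift `U` on `ℓ²(ℤ, H)`, `(U ξ)(n) = ξ(n - 1)`. -/
def shift : L2Z H →L[ℂ] L2Z H :=
  LinearMap.mkContinuous
    { toFun ξ := ⟨fun n => ξ (n - 1), by
        have h := (memℓp_gen_iff (by norm_num)).mp (lp.memℓp ξ)
        exact (memℓp_gen_iff (by norm_num)).mpr ((Equiv.subRight (1 : ℤ)).summable_iff.mpr h)⟩
      map_add' _ _ := rfl
      map_smul' _ _ := rfl }
    1
    (fun ξ => by
      rw [one_mul, lp.norm_eq_tsum_rpow (by norm_num), lp.norm_eq_tsum_rpow (by norm_num)]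
      exact le_of_eq (congrArg (· ^ _)
        ((Equiv.subRight (1 : ℤ)).tsum_eq fun n => ‖ξ n‖ ^ (2 : ENNReal).toReal)))

lemma shift_apply (ξ : L2Z H) (n : ℤ) : shift H ξ n = ξ (n - 1) := rfl

/-- The projection `p` of `ℓ²(ℤ, H)` on the nonnegative frequencies. -/
def posProj : L2Z H →L[ℂ] L2Z H :=
  lp.mapCLM 2 (fun n : ℤ => if 0 ≤ n then ContinuousLinearMap.id ℂ H else 0) zero_le_one
    (fun n => by
      split_ifs
      · exact ContinuousLinearMap.norm_id_le
      · simp)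

lemma posProj_apply (ξ : L2Z H) (n : ℤ) : posProj H ξ n = if 0 ≤ n then ξ n else 0 := by
  change (if 0 ≤ n then ContinuousLinearMap.id ℂ H else 0) (ξ n) = _
  split_ifs <;> rfl

lemma posProj_posProj (ξ : L2Z H) : posProj H (posProj H ξ) = posProj H ξ := by
  ext n
  simp only [posProj_apply]
  split_ifs <;> rfl

lemma inner_posProj (ξ η : L2Z H) : inner ℂ (posProj H ξ) η = inner ℂ ξ (posProj H η) := by
  simp only [lp.inner_eq_tsum, posProj_apply]
  refine tsum_congr fun n => ?_
  split_ifs <;> simp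

/-- The range `p ℓ²(ℤ, H)` of the projection `p`, as a subspace of `ℓ²(ℤ, H)`. -/
def posSubspace : Submodule ℂ (L2Z H) := (posProj H : L2Z H →ₗ[ℂ] L2Z H).range

variable {H}

lemma posProj_mem (ξ : L2Z H) : posProj H ξ ∈ posSubspace H := ⟨ξ, rfl⟩

lemma posProj_of_mem {ξ : L2Z H} (hξ : ξ ∈ posSubspace H) : posProj H ξ = ξ := by
  obtain ⟨η, rfl⟩ := hξ
  exact posProj_posProj H η

lemma isClosed_posSubspace : IsClosed (posSubspace H : Set (L2Z H)) := by
  have : (posSubspace H : Set (L2Z H)) = {ξ | posProj H ξ = ξ} := by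
    ext ξ
    exact ⟨posProj_of_mem, fun h => ⟨ξ, h⟩⟩
  rw [this]
  exact isClosed_eq (posProj H).continuous continuous_id

variable (H) in
/-- The Hilbert space `p ℓ²(ℤ, H)`. -/
def PosSpace : Type w := posSubspace H

instance : NormedAddCommGroup (PosSpace H) := inferInstanceAs (NormedAddCommGroup (posSubspace H))

instance : InnerProductSpace ℂ (PosSpace H) :=
  inferInstanceAs (InnerProductSpace ℂ (posSubspace H))

instance : CompleteSpace (PosSpace H) := isClosed_posSubspace.completeSpace_coe

variable (H) in
/-- The inclusion of `p ℓ²(ℤ, H)` in `ℓ²(ℤ, H)`. -/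
def posIncl : PosSpace H →L[ℂ] L2Z H := (posSubspace H).subtypeL

variable (H) in
/-- The projection `p`, as a map of `ℓ²(ℤ, H)` onto `p ℓ²(ℤ, H)`. -/
def posRestrict : L2Z H →L[ℂ] PosSpace H := (posProj H).codRestrict (posSubspace H) posProj_mem

lemma posIncl_injective : Function.Injective (posIncl H) := Subtype.val_injective

lemma posProj_posIncl (ξ : PosSpace H) : posProj H (posIncl H ξ) = posIncl H ξ :=
  posProj_of_mem ξ.2

lemma posIncl_posRestrict (ξ : L2Z H) : posIncl H (posRestrict H ξ) = posProj H ξ := rfl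

lemma inner_posIncl (ξ η : PosSpace H) : inner ℂ (posIncl H ξ) (posIncl H η) = inner ℂ ξ η := rfl

/-- The compression `p x p` of an operator `x`, as an operator on `p ℓ²(ℤ, H)`. -/
def compress (x : L2Z H →L[ℂ] L2Z H) : PosSpace H →L[ℂ] PosSpace H :=
  (posRestrict H).comp (x.comp (posIncl H))

lemma posIncl_compress (x : L2Z H →L[ℂ] L2Z H) (ξ : PosSpace H) :
    posIncl H (compress x ξ) = posProj H (x (posIncl H ξ)) := rfl

lemma compress_star (x : L2Z H →L[ℂ] L2Z H) : compress (star x) = star (compress x) := by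
  refine (ContinuousLinearMap.eq_adjoint_iff _ _).mpr fun ξ η => ?_
  rw [← inner_posIncl, ← inner_posIncl, posIncl_compress, posIncl_compress, inner_posProj,
    posProj_posIncl, ← inner_posProj, posProj_posIncl, ContinuousLinearMap.star_eq_adjoint,
    ContinuousLinearMap.adjoint_inner_left]

end Space

variable {B : Type u} [CStarAlgebra B] {H : Type w} [NormedAddCommGroup H]
  [InnerProductSpace ℂ H] [CompleteSpace H]

/-- The representation `π̃` of `B` on `ℓ²(ℤ, H)` induced from a representation `π` on `H`,
`(π̃(b) ξ)(n) = π(β⁻ⁿ(b)) ξ(n)`. -/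
def inducedRep (β : B ≃⋆ₐ[ℂ] B) (π : B →⋆ₐ[ℂ] (H →L[ℂ] H)) :
    B →⋆ₐ[ℂ] (L2Z H →L[ℂ] L2Z H) :=
  directSum fun n : ℤ => π.comp ((β ^ (-n) : B ≃⋆ₐ[ℂ] B).toStarAlgHom)

lemma inducedRep_apply (β : B ≃⋆ₐ[ℂ] B) (π : B →⋆ₐ[ℂ] (H →L[ℂ] H)) (b : B) (ξ : L2Z H) (n : ℤ) :
    inducedRep β π b ξ n = π ((β ^ (-n)) b) (ξ n) := rfl

lemma inducedRep_posProj (β : B ≃⋆ₐ[ℂ] B) (π : B →⋆ₐ[ℂ] (H →L[ℂ] H)) (b : B) (ξ : L2Z H) :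
    inducedRep β π b (posProj H ξ) = posProj H (inducedRep β π b ξ) := by
  ext n
  simp only [inducedRep_apply, posProj_apply]
  split_ifs <;> simp

/-- The representation `b ↦ π̃(b) p` of `B` on `p ℓ²(ℤ, H)`. -/
def posRep (β : B ≃⋆ₐ[ℂ] B) (π : B →⋆ₐ[ℂ] (H →L[ℂ] H)) :
    B →⋆ₐ[ℂ] (PosSpace H →L[ℂ] PosSpace H) where
  toFun b := compress (inducedRep β π b)
  map_one' := by
    ext1 ξ
    apply posIncl_injective
    rw [posIncl_compress, map_one]
    exact posProj_posIncl ξ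
  map_mul' a b := by
    ext1 ξ
    apply posIncl_injective
    rw [mul_apply_eq_comp, posIncl_compress, posIncl_compress, posIncl_compress, map_mul,
      inducedRep_posProj, posProj_posProj]
    rfl
  map_zero' := by
    ext1 ξ
    apply posIncl_injective
    rw [posIncl_compress, map_zero]
    exact map_zero (posProj H)
  map_add' a b := by
    ext1 ξ
    apply posIncl_injective
    rw [posIncl_compress, map_add]
    exact map_add (posProj H) _ _
  commutes' c := by
    ext1 ξ
    apply posIncl_injective
    rw [posIncl_compress, AlgHomClass.commutes, Algebra.algebraMap_eq_smul_one,
      Algebra.algebraMap_eq_smul_one]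
    exact (map_smul (posProj H) c _).trans (congrArg (c • ·) (posProj_posIncl ξ))
  map_star' b := by rw [map_star, compress_star]

/-- The crossed product `B ⋊_β ℤ`: the C*-algebra generated by `π̃_u(B)` and `U` on
`ℓ²(ℤ, H_u)`, where `π_u` is the universal representation of `B`. -/
def crossedProductZ (β : B ≃⋆ₐ[ℂ] B) :
    StarSubalgebra ℂ (L2Z (UniversalSpace B) →L[ℂ] L2Z (UniversalSpace B)) :=
  (StarAlgebra.adjoin ℂ (Set.range (inducedRep β (universalRep B)) ∪
    {shift (UniversalSpace B)})).topologicalClosure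

end CrossedProduct

/-! ### The crossed product by an endomorphism -/

section Endomorphism

variable {A : Type u} [CStarAlgebra A]

/-- A covariant representation `(H, π, W)` of `(A, α)`: `π` is a unital representation of `A` on
the Hilbert space `H` and `W` is an isometry on `H`, with `π(α(a)) W = W π(a)` and with all the
range projections `W ^ k (W *) ^ k` in the commutant of `π(A)`. -/
structure IsCovariantRep (α : A →⋆ₐ[ℂ] A) {H : Type v} [NormedAddCommGroup H]
    [InnerProductSpace ℂ H] [CompleteSpace H] (π : A →⋆ₐ[ℂ] (H →L[ℂ] H)) (W : H →L[ℂ] H) :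
    Prop where
  isometry : Isometry W
  covariant : ∀ a, π (α a) * W = W * π a
  commute : ∀ (k : ℕ) (a : A), Commute (W ^ k * star W ^ k) (π a)

/-- `(B, ι, t)` is the crossed product of `A` with `ℕ` by `α`. The universal property refers to the
covariant representations on Hilbert spaces in the universe `v`. -/
structure IsCrossedProductN (α : A →⋆ₐ[ℂ] A) (B : Type w) [CStarAlgebra B] (ι : A →⋆ₐ[ℂ] B)
    (t : B) : Prop where
  injective : Function.Injective ι
  isometry : star t * t = 1
  generate : (StarAlgebra.adjoin ℂ (Set.range ι ∪ {t})).topologicalClosure = ⊤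
  covariant : ∀ a, ι (α a) * t = t * ι a
  commute : ∀ (k : ℕ) (a : A), Commute (t ^ k * star t ^ k) (ι a)
  universal : ∀ (H : Type v) [NormedAddCommGroup H] [InnerProductSpace ℂ H] [CompleteSpace H]
    (π : A →⋆ₐ[ℂ] (H →L[ℂ] H)) (W : H →L[ℂ] H), IsCovariantRep α π W →
    ∃ π' : B →⋆ₐ[ℂ] (H →L[ℂ] H), (∀ a, π' (ι a) = π a) ∧ π' t = W

variable (α : A →⋆ₐ[ℂ] A) (hα : Function.Injective α)

/-- The Hilbert space `H_u` of the universal representation `π_u` of `A_∞`. -/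
abbrev HU : Type u := UniversalSpace (Limit α hα)

/-- The representation `ι_A(a) = π̃_u(φ_{∞ 0}(a)) p` of `A` on `p ℓ²(ℤ, H_u)`. -/
def concreteRep : A →⋆ₐ[ℂ] (PosSpace (HU α hα) →L[ℂ] PosSpace (HU α hα)) :=
  (posRep (limitAut α hα) (universalRep (Limit α hα))).comp (limitMap α hα 0)

/-- The operator `t = p U p` on `p ℓ²(ℤ, H_u)`. -/
def concreteIsometry : PosSpace (HU α hα) →L[ℂ] PosSpace (HU α hα) :=
  compress (shift (HU α hα))

/-- The C*-algebra `C*(A, α, ℕ)` generated by `ι_A(A)` and `t` on `p ℓ²(ℤ, H_u)`. -/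
def concreteAlgebra : StarSubalgebra ℂ (PosSpace (HU α hα) →L[ℂ] PosSpace (HU α hα)) :=
  (StarAlgebra.adjoin ℂ (Set.range (concreteRep α hα) ∪ {concreteIsometry α hα})).topologicalClosure

instance : IsClosed (concreteAlgebra α hα : Set (PosSpace (HU α hα) →L[ℂ] PosSpace (HU α hα))) :=
  StarSubalgebra.isClosed_topologicalClosure _

lemma concreteRep_mem (a : A) : concreteRep α hα a ∈ concreteAlgebra α hα :=
  StarSubalgebra.le_topologicalClosure _ (StarAlgebra.subset_adjoin ℂ _ (Or.inl ⟨a, rfl⟩))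

lemma concreteIsometry_mem : concreteIsometry α hα ∈ concreteAlgebra α hα :=
  StarSubalgebra.le_topologicalClosure _ (StarAlgebra.subset_adjoin ℂ _ (Or.inr rfl))

/-- `ι_A` as a map of `A` to `C*(A, α, ℕ)`. -/
def concreteIncl : A →⋆ₐ[ℂ] concreteAlgebra α hα :=
  (concreteRep α hα).codRestrict (concreteAlgebra α hα) (concreteRep_mem α hα)

/-- `t` as an element of `C*(A, α, ℕ)`. -/
def concreteElement : concreteAlgebra α hα :=
  ⟨concreteIsometry α hα, concreteIsometry_mem α hα⟩

end Endomorphism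

end CStarCrossedProduct

end

open CStarCrossedProduct

/-!
The universal property rests on a comparison of norms: for a covariant representation `(π, W)`, the
assignment `ι_A(a) ↦ π(a)`, `t ↦ W` must not increase the norm of any `*`-polynomial. No unitary
dilation of `W` is needed for this. In any C*-algebra, a covariant pair `(ι, t)` gives rise to the
`*`-homomorphisms `e_k(a) = (t*) ^ k ι(a) t ^ k`, which satisfy `e_{k + 1}(α(a)) = e_k(a)` and
`t e_k(a) = e_k(α(a)) t` and commute with the projections `t ^ m (t*) ^ m`. So the `*`-algebra
generated by `ι(A)` and `t` is spanned by the monomials `e_k(a) t ^ m (t*) ^ n`, and it is graded by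
`m - n`, in the weak sense that the parts span and multiply as they should.

* In degree zero an element is a finite sum `∑ e_k(f_m) t ^ m (t*) ^ m`, and its norm is at most the
  supremum of the norms of the partial sums `f_0 + ⋯ + f_l` (`IsCovariantPair.norm_finsupp_sum_le`).
  In the concrete pair the diagonal matrix entry at position `l` is
  `π_u(α_∞⁻ˡ(φ_{∞ k}(f_0 + ⋯ + f_l)))`. Since `π_u` is faithful (`universalRep_injective`), the
  concrete norm dominates all others in degree zero (`IsCovariantPair.norm_snd_le_of_diagEntry`).
* For a general `x = ∑ x_j` with `|j| ≤ J`, the degree zero part `∑ x_j* x_j` of `x* x` gives the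
  comparison up to the factor `2 J + 1` (`IsCovariantPair.sq_norm_snd_le`). Applied to the powers of
  `x* x`, whose degrees grow linearly, it gives the comparison without a factor
  (`IsCovariantPair.norm_snd_le_norm_fst`). This step takes the place of an averaging argument for
  the amenable group `ℤ`.

Hence, in the C*-algebra generated by the pairs `(ι_A(a), π(a))` and `(t, W)`, the first coordinate
determines the second, and the graph so obtained is the required representation
(`IsCovariantPair.exists_extension`).

For the compression, `A_∞ ⋊ ℤ` is the closed span of the `π̃_u(x) U ^ n` and `π̃_u(x) (U*) ^ n`,
whose compressions are `π̃_u(x) p t ^ n` and `π̃_u(x) p (t*) ^ n`; and `π̃_u(φ_{∞ k}(a)) p = e_k(a)`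
(`concrete_level`).
-/

noncomputable section

namespace CStarCrossedProduct

/-! ### States separate the points of a C*-algebra -/

section States

variable {B : Type u} [CStarAlgebra B]

attribute [local instance] CStarAlgebra.spectralOrder CStarAlgebra.spectralOrderedRing

open scoped ComplexOrder

/-- The norm of a normalised functional on the shifted element `b + i s` is at most
`(‖b‖ ^ 2 + s ^ 2) ^ (1 / 2)`, which for large `s` leaves no room for an imaginary part. -/
lemma im_apply_eq_zero_of_isSelfAdjoint {g : B →L[ℂ] ℂ} (hg : ‖g‖ ≤ 1) (h1 : g 1 = 1) {b : B}
    (hb : IsSelfAdjoint b) : (g b).im = 0 := by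
  have key : ∀ s : ℝ, ((g b).im + s) ^ 2 ≤ ‖b‖ ^ 2 + s ^ 2 := by
    intro s
    set c : B := b + (s * Complex.I : ℂ) • (1 : B) with hc
    have h2 : star c * c = b * b + ((s ^ 2 : ℝ) : ℂ) • (1 : B) := by
      have hI : star (s * Complex.I : ℂ) = -(s * Complex.I) := by simp
      rw [hc, star_add, star_smul, star_one, hb.star_eq, hI]
      simp only [add_mul, mul_add, smul_mul_assoc, mul_smul_comm, one_mul, mul_one]
      match_scalars <;>
        first
          | ring1
          | linear_combination -(s : ℂ) ^ 2 * Complex.I_sq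
    have h3 : ‖c‖ ^ 2 ≤ ‖b‖ ^ 2 + s ^ 2 := by
      rw [sq ‖c‖, ← CStarRing.norm_star_mul_self, h2]
      refine (norm_add_le _ _).trans (add_le_add ((norm_mul_le _ _).trans_eq (sq _).symm) ?_)
      rw [norm_smul, Complex.norm_real, Real.norm_of_nonneg (sq_nonneg s)]
      have : Nontrivial B := ⟨1, 0, fun h => by simp [h] at h1⟩
      rw [CStarRing.norm_one, mul_one]
    have h4 : ‖g c‖ ≤ ‖c‖ := (g.le_opNorm c).trans (mul_le_of_le_one_left (norm_nonneg _) hg)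
    have h5 : (g c).im = (g b).im + s := by simp [hc, h1]
    have h6 := Complex.abs_im_le_norm (g c)
    rw [h5] at h6
    calc ((g b).im + s) ^ 2 = |(g b).im + s| ^ 2 := (sq_abs _).symm
      _ ≤ ‖c‖ ^ 2 := by gcongr; exact h6.trans h4
      _ ≤ _ := h3
  by_contra hne
  have := key (((‖b‖ ^ 2 + 1) / (2 * (g b).im)))
  have h7 : 2 * (g b).im * ((‖b‖ ^ 2 + 1) / (2 * (g b).im)) = ‖b‖ ^ 2 + 1 := by
    field_simp
  nlinarith [sq_nonneg (g b).im]

/-- A functional of norm at most `1` with value `1` at the unit is positive. -/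
lemma nonneg_apply_of_norm_le_one {g : B →L[ℂ] ℂ} (hg : ‖g‖ ≤ 1) (h1 : g 1 = 1) {b : B}
    (hb : 0 ≤ b) : 0 ≤ g b := by
  have hsa : IsSelfAdjoint b := .of_nonneg hb
  have him := im_apply_eq_zero_of_isSelfAdjoint hg h1 hsa
  have hle : b ≤ algebraMap ℝ B ‖b‖ := IsSelfAdjoint.le_algebraMap_norm_self
  have h2 : ‖algebraMap ℝ B ‖b‖ - b‖ ≤ ‖b‖ :=
    (CStarAlgebra.norm_le_iff_le_algebraMap _ (norm_nonneg b) (sub_nonneg.mpr hle)).mpr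
      (sub_le_self _ hb)
  have h3 : ‖g (algebraMap ℝ B ‖b‖ - b)‖ ≤ ‖b‖ :=
    (g.le_opNorm _).trans ((mul_le_of_le_one_left (norm_nonneg _) hg).trans h2)
  have h4 : g (algebraMap ℝ B ‖b‖) = (‖b‖ : ℂ) := by
    rw [Algebra.algebraMap_eq_smul_one, ← Complex.coe_smul, map_smul, h1, smul_eq_mul, mul_one]
  have h5 := (Complex.re_le_norm _).trans h3
  rw [map_sub, h4, Complex.sub_re, Complex.ofReal_re] at h5
  exact Complex.nonneg_iff.mpr ⟨by linarith, him.symm⟩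

/-- Every positive element attains its norm at a state: a Hahn-Banach functional that attains the
norm `1 + ‖a‖` at `1 + a` must attain the norms of both summands. -/
lemma exists_state_apply_eq_norm [Nontrivial B] {a : B} (ha : 0 ≤ a) :
    ∃ f : State B, f.1 a = (‖a‖ : ℂ) := by
  obtain ⟨g, hg, hga⟩ := exists_dual_vector'' ℂ (1 + a)
  have hle : ∀ x, ‖g x‖ ≤ ‖x‖ := fun x =>
    (g.le_opNorm _).trans (mul_le_of_le_one_left (norm_nonneg _) hg)
  have hnorm : 1 + ‖a‖ ≤ ‖1 + a‖ := by
    have h0 : (0 : B) ≤ 1 + a := add_nonneg zero_le_one ha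
    have h1 : 1 ≤ ‖1 + a‖ := by
      have := CStarAlgebra.norm_le_norm_of_nonneg_of_le (zero_le_one (α := B))
        (le_add_of_nonneg_right ha)
      rwa [CStarRing.norm_one] at this
    have h2 := (CStarAlgebra.norm_le_iff_le_algebraMap _ (norm_nonneg _) h0).mp le_rfl
    have h3 : a ≤ algebraMap ℝ B (‖1 + a‖ - 1) := by
      rw [map_sub, map_one]
      exact le_sub_iff_add_le'.mpr h2
    linarith [(CStarAlgebra.norm_le_iff_le_algebraMap a (sub_nonneg.mpr h1) ha).mpr h3]
  have hre : (g 1).re + (g a).re = ‖1 + a‖ := by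
    rw [← Complex.add_re, ← map_add, hga]
    simp
  have h1re : (g 1).re ≤ 1 :=
    (Complex.re_le_norm _).trans ((hle 1).trans_eq CStarRing.norm_one)
  have hare : (g a).re ≤ ‖a‖ := (Complex.re_le_norm _).trans (hle a)
  have eq_of_re : ∀ {z : ℂ} {r : ℝ}, ‖z‖ ≤ r → z.re = r → z = r := by
    intro z r hz hr
    have h := Complex.sq_norm_sub_sq_re z
    have h' : ‖z‖ = r := le_antisymm hz (hr ▸ Complex.re_le_norm z)
    rw [h', hr, sub_self] at h
    exact Complex.ext hr (by simpa using (pow_eq_zero_iff two_ne_zero).mp h.symm)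
  have hg1 : g 1 = 1 := by
    rw [eq_of_re ((hle 1).trans_eq CStarRing.norm_one) (by linarith), Complex.ofReal_one]
  have hgA : g a = (‖a‖ : ℂ) := eq_of_re (hle a) (by linarith)
  exact ⟨⟨PositiveLinearMap.mk₀ (g : B →ₗ[ℂ] ℂ)
    fun x hx => nonneg_apply_of_norm_le_one hg hg1 hx, hg1⟩, hgA⟩

lemma universalRep_injective : Function.Injective (universalRep B) := by
  refine (injective_iff_map_eq_zero _).mpr fun x hx => ?_
  by_contra hne
  have : Nontrivial B := ⟨x, 0, hne⟩
  obtain ⟨f, hf⟩ := exists_state_apply_eq_norm (star_mul_self_nonneg x)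
  -- the class of `1` in the GNS space of `f`, on which `x` acts with norm `f (x* x) ^ (1 / 2)`
  set e : f.1.GNS := ((f.1.toPreGNS 1 : f.1.PreGNS) : f.1.GNS)
  have h1 : f.1.gnsStarAlgHom x e = 0 := by
    classical
    have h := congrArg (fun T => T (lp.single 2 f e)) hx
    have h' := congrFun (congrArg Subtype.val h) f
    have h'' : f.1.gnsStarAlgHom x (lp.single (E := fun f : State B => f.1.GNS) 2 f e f) = 0 := h'
    rwa [lp.single_apply_self] at h''
  have h2 : f.1.gnsStarAlgHom x e = ((f.1.toPreGNS x : f.1.PreGNS) : f.1.GNS) := by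
    change f.1.gnsNonUnitalStarAlgHom x ((f.1.toPreGNS 1 : f.1.PreGNS) : f.1.GNS) = _
    rw [PositiveLinearMap.gnsNonUnitalStarAlgHom_apply_coe,
      PositiveLinearMap.leftMulMapPreGNS_apply, PositiveLinearMap.ofPreGNS_toPreGNS, mul_one]
  have h3 : ‖f.1.toPreGNS x‖ = 0 := by
    rw [← UniformSpace.Completion.norm_coe, ← h2, h1, norm_zero]
  have h4 := f.1.preGNS_norm_sq (f.1.toPreGNS x)
  rw [h3, PositiveLinearMap.ofPreGNS_toPreGNS, hf, CStarRing.norm_star_mul_self] at h4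
  have h5 : ‖x‖ * ‖x‖ = 0 := by
    have : ((‖x‖ * ‖x‖ : ℝ) : ℂ) = 0 := by rw [← h4]; simp
    exact_mod_cast this
  exact hne (norm_eq_zero.mp (mul_self_eq_zero.mp h5))

end States

/-! ### Covariant pairs in a C*-algebra -/

section CovariantPair

variable {A : Type u} [CStarAlgebra A] {E : Type v} [CStarAlgebra E]

/-- A covariant pair for `(A, α)` in a C*-algebra `E`: the relations of a covariant representation,
without reference to a Hilbert space. -/
structure IsCovariantPair (α : A →⋆ₐ[ℂ] A) (ι : A →⋆ₐ[ℂ] E) (t : E) : Prop where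
  isometry : star t * t = 1
  covariant : ∀ a, ι (α a) * t = t * ι a
  commute : ∀ (k : ℕ) (a : A), Commute (t ^ k * star t ^ k) (ι a)

lemma IsCovariantPair.prod {F : Type w} [CStarAlgebra F] {α : A →⋆ₐ[ℂ] A} {ι₁ : A →⋆ₐ[ℂ] E}
    {ι₂ : A →⋆ₐ[ℂ] F} {t₁ : E} {t₂ : F} (h₁ : IsCovariantPair α ι₁ t₁)
    (h₂ : IsCovariantPair α ι₂ t₂) : IsCovariantPair α (ι₁.prod ι₂) (t₁, t₂) where
  isometry := Prod.ext h₁.isometry h₂.isometry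
  covariant a := Prod.ext (h₁.covariant a) (h₂.covariant a)
  commute k a := Prod.ext (h₁.commute k a) (h₂.commute k a)

/-- Along a decreasing sequence of projections `Q` that commute with a representation `θ`, the map
`y ↦ ∑ θ(y_j) (Q_j - Q_{j + 1})` is a `*`-homomorphism of a product of copies of `A`, hence
contractive. -/
lemma norm_sum_mul_sub_le (θ : A →⋆ₐ[ℂ] E) (Q : ℕ → E)
    (hsa : ∀ m, star (Q m) = Q m) (hQ : ∀ i j, i ≤ j → Q i * Q j = Q j)
    (hc : ∀ m a, Commute (Q m) (θ a)) (N : ℕ) (y : ℕ → A) {c : ℝ} (hc0 : 0 ≤ c)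
    (hy : ∀ j, ‖y j‖ ≤ c) :
    ‖∑ j : Fin N, θ (y j) * (Q j - Q (j + 1))‖ ≤ c := by
  have hQ' : ∀ i j, i ≤ j → Q j * Q i = Q j := fun i j hij => by
    simpa only [star_mul, hsa] using congrArg star (hQ i j hij)
  set R : ℕ → E := fun j => Q j - Q (j + 1) with hR
  have hRsa : ∀ j, star (R j) = R j := fun j => by simp [hR, hsa]
  have hRc : ∀ j a, Commute (R j) (θ a) := fun j a => (hc j a).sub_left (hc (j + 1) a)
  have hRR : ∀ j, R j * R j = R j := fun j => by
    simp only [hR, sub_mul, mul_sub, hQ j j le_rfl, hQ j (j + 1) j.le_succ, hQ' j (j + 1) j.le_succ,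
      hQ (j + 1) (j + 1) le_rfl]
    abel
  have hlt : ∀ i j, i < j → R i * R j = 0 := fun i j hij => by
    simp only [hR, sub_mul, mul_sub, hQ i j hij.le, hQ i (j + 1) (by omega), hQ (i + 1) j hij,
      hQ (i + 1) (j + 1) (by omega)]
    abel
  have hne : ∀ i j, i ≠ j → R i * R j = 0 := fun i j hij => by
    rcases lt_or_gt_of_ne hij with hij | hij
    · exact hlt i j hij
    · simpa only [star_mul, hRsa, star_zero] using congrArg star (hlt j i hij)
  let Ψ : (Fin N → A) →⋆ₙₐ[ℂ] E :=
    { toFun z := ∑ j : Fin N, θ (z j) * R j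
      map_smul' s z := by simp [Finset.smul_sum]
      map_zero' := by simp
      map_add' z z' := by simp [add_mul, Finset.sum_add_distrib]
      map_mul' z z' := by
        rw [Finset.sum_mul_sum]
        refine Finset.sum_congr rfl fun i _ => ?_
        have hij : ∀ j : Fin N, θ (z i) * R i * (θ (z' j) * R j) =
            θ (z i) * θ (z' j) * (R i * R j) := fun j => by
          rw [mul_assoc, ← mul_assoc (R i), (hRc i (z' j)).eq]
          simp only [mul_assoc]
        rw [Finset.sum_eq_single i, hij, hRR, Pi.mul_apply, map_mul]
        · intro j _ hj
          rw [hij, hne i j (fun he => hj (Fin.ext he.symm)), mul_zero]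
        · simp
      map_star' z := by
        rw [star_sum]
        refine Finset.sum_congr rfl fun i _ => ?_
        rw [star_mul, hRsa, ← map_star, (hRc _ _).eq, Pi.star_apply] }
  exact (NonUnitalStarAlgHom.norm_apply_le Ψ fun j : Fin N => y j).trans
    ((pi_norm_le_iff_of_nonneg hc0).mpr fun j => hy j)

namespace IsCovariantPair

variable {α : A →⋆ₐ[ℂ] A} {ι : A →⋆ₐ[ℂ] E} {t : E} (h : IsCovariantPair α ι t)

lemma star_pow_mul_pow (h : IsCovariantPair α ι t) (k : ℕ) : star t ^ k * t ^ k = 1 := by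
  induction k with
  | zero => simp
  | succ k ih =>
    rw [pow_succ, pow_succ', mul_assoc, ← mul_assoc (star t) t, h.isometry, one_mul, ih]

lemma star_pow_mul_pow_of_le (h : IsCovariantPair α ι t) {n p : ℕ} (hnp : n ≤ p) :
    star t ^ n * t ^ p = t ^ (p - n) := by
  obtain ⟨q, rfl⟩ := Nat.exists_eq_add_of_le hnp
  rw [pow_add, ← mul_assoc, h.star_pow_mul_pow, one_mul, Nat.add_sub_cancel_left]

lemma star_pow_mul_pow_of_ge (h : IsCovariantPair α ι t) {n p : ℕ} (hnp : p ≤ n) :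
    star t ^ n * t ^ p = star t ^ (n - p) := by
  obtain ⟨q, rfl⟩ := Nat.exists_eq_add_of_le hnp
  rw [add_comm, pow_add, mul_assoc, h.star_pow_mul_pow, mul_one, Nat.add_sub_cancel]

/-- The representation `a ↦ (t*) ^ k ι(a) t ^ k` of `A`. It is multiplicative because `t ^ k (t*) ^ k`
commutes with `ι(A)`. For varying `k` these maps are the restrictions, to the copies of `A`, of the
representation of the inductive limit that `(ι, t)` gives rise to. -/
def level (k : ℕ) : A →⋆ₐ[ℂ] E where
  toFun a := star t ^ k * ι a * t ^ k
  map_one' := by rw [map_one, mul_one, h.star_pow_mul_pow]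
  map_mul' a b := by
    calc star t ^ k * ι (a * b) * t ^ k
        = (star t ^ k * t ^ k) * star t ^ k * (ι a * ι b) * t ^ k := by
          rw [h.star_pow_mul_pow, one_mul, map_mul]
      _ = star t ^ k * ((t ^ k * star t ^ k) * ι a) * ι b * t ^ k := by simp only [mul_assoc]
      _ = star t ^ k * (ι a * (t ^ k * star t ^ k)) * ι b * t ^ k := by rw [(h.commute k a).eq]
      _ = _ := by simp only [mul_assoc]
  map_zero' := by simp
  map_add' a b := by rw [map_add, mul_add, add_mul]
  commutes' c := by
    rw [AlgHomClass.commutes, ← Algebra.commutes, mul_assoc, h.star_pow_mul_pow, mul_one]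
  map_star' a := by simp only [map_star, star_mul, star_pow, star_star, mul_assoc]

lemma level_apply (k : ℕ) (a : A) : h.level k a = star t ^ k * ι a * t ^ k := rfl

lemma level_zero (a : A) : h.level 0 a = ι a := by simp [level_apply]

lemma level_succ_apply (k : ℕ) (a : A) : h.level (k + 1) (α a) = h.level k a := by
  rw [level_apply, level_apply, pow_succ' t, ← mul_assoc, mul_assoc _ (ι (α a)), h.covariant,
    pow_succ, mul_assoc (star t ^ k) (star t), ← mul_assoc (star t) t, h.isometry, one_mul]

lemma level_add_apply (k j : ℕ) (a : A) : h.level (k + j) ((α ^ j) a) = h.level k a := by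
  induction j with
  | zero => rfl
  | succ j ih =>
    rw [pow_succ']
    exact (h.level_succ_apply (k + j) ((α ^ j) a)).trans ih

lemma level_mul_star (k : ℕ) (a : A) :
    h.level (k + 1) a * star t = star t * h.level k a := by
  have hs : star t ^ (k + 1) * t ^ k = star t := by
    rw [h.star_pow_mul_pow_of_ge k.le_succ, Nat.succ_sub le_rfl, Nat.sub_self, pow_one]
  calc h.level (k + 1) a * star t
      = star t ^ (k + 1) * (ι a * (t ^ (k + 1) * star t ^ (k + 1))) * t ^ k := by
        rw [level_apply]
        nth_rw 2 [← hs]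
        simp only [mul_assoc]
    _ = star t ^ (k + 1) * t ^ (k + 1) * star t ^ (k + 1) * ι a * t ^ k := by
        rw [← (h.commute (k + 1) a).eq]
        simp only [mul_assoc]
    _ = star t * h.level k a := by
        rw [h.star_pow_mul_pow, one_mul, pow_succ', level_apply]
        simp only [mul_assoc]

lemma level_mul (k : ℕ) (a : A) : h.level k a * t = t * h.level (k + 1) a := by
  have := congrArg star (h.level_mul_star k (star a))
  simpa only [map_star, star_mul, star_star] using this.symm

lemma level_mul_pow (k m : ℕ) (a : A) : h.level k a * t ^ m = t ^ m * h.level (k + m) a := by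
  induction m with
  | zero => simp
  | succ m ih =>
    rw [pow_succ, ← mul_assoc, ih, mul_assoc, level_mul, ← mul_assoc, add_assoc]

lemma star_pow_mul_level (k m : ℕ) (a : A) :
    star t ^ m * h.level k a = h.level (k + m) a * star t ^ m := by
  have := congrArg star (h.level_mul_pow k m (star a))
  simpa only [map_star, star_mul, star_star, star_pow] using this

lemma pow_mul_level (k m : ℕ) (a : A) : t ^ m * h.level k a = h.level k ((α ^ m) a) * t ^ m := by
  rw [level_mul_pow, level_add_apply]

lemma commute_level (k m : ℕ) (a : A) : Commute (t ^ m * star t ^ m) (h.level k a) := by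
  rw [commute_iff_eq, mul_assoc, star_pow_mul_level, ← mul_assoc, ← level_mul_pow, mul_assoc]

lemma level_mul_level (k l : ℕ) (a b : A) :
    h.level k a * h.level l b = h.level (k + l) ((α ^ l) a * (α ^ k) b) := by
  rw [map_mul, level_add_apply, add_comm, level_add_apply]

lemma range_mul_range (h : IsCovariantPair α ι t) {i j : ℕ} (hij : i ≤ j) :
    (t ^ i * star t ^ i) * (t ^ j * star t ^ j) = t ^ j * star t ^ j := by
  rw [mul_assoc, ← mul_assoc (star t ^ i), h.star_pow_mul_pow_of_le hij, ← mul_assoc, ← pow_add,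
    Nat.add_sub_cancel' hij]

/-! ### The grading of the `*`-algebra generated by a covariant pair -/

/-- The monomials `e_k(a) t ^ m (t*) ^ n`, where `e_k(a) = (t*) ^ k ι(a) t ^ k`, form a
multiplicative set. -/
lemma monomial_mul_monomial (k m n l p q : ℕ) (a b : A) :
    ∃ (r : ℕ) (c : A) (m' n' : ℕ), (m' : ℤ) - n' = (m - n) + (p - q) ∧
      (h.level k a * t ^ m * star t ^ n) * (h.level l b * t ^ p * star t ^ q) =
        h.level r c * t ^ m' * star t ^ n' := by
  have key : (h.level k a * t ^ m * star t ^ n) * (h.level l b * t ^ p * star t ^ q) =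
      h.level (k + (l + n)) ((α ^ (l + n)) a * (α ^ k) ((α ^ m) b)) *
        (t ^ m * (star t ^ n * t ^ p) * star t ^ q) := by
    rw [← level_mul_level]
    calc _ = h.level k a * t ^ m * (star t ^ n * h.level l b) * t ^ p * star t ^ q := by
          simp only [mul_assoc]
      _ = h.level k a * (t ^ m * h.level (l + n) b) * star t ^ n * t ^ p * star t ^ q := by
          rw [star_pow_mul_level]
          simp only [mul_assoc]
      _ = _ := by
          rw [pow_mul_level]
          simp only [mul_assoc]
  rcases le_total n p with hnp | hnp
  · refine ⟨k + (l + n), (α ^ (l + n)) a * (α ^ k) ((α ^ m) b), m + (p - n), q, by omega, ?_⟩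
    rw [key, h.star_pow_mul_pow_of_le hnp, ← pow_add, ← mul_assoc]
  · refine ⟨k + (l + n), (α ^ (l + n)) a * (α ^ k) ((α ^ m) b), m, n - p + q, by omega, ?_⟩
    rw [key, h.star_pow_mul_pow_of_ge hnp, mul_assoc (t ^ m), ← pow_add, ← mul_assoc]

lemma star_monomial (k m n : ℕ) (a : A) :
    ∃ (r : ℕ) (c : A), star (h.level k a * t ^ m * star t ^ n) =
      h.level r c * t ^ n * star t ^ m := by
  refine ⟨k + m, (α ^ n) (star a), ?_⟩
  rw [star_mul, star_mul, star_pow, star_pow, star_star, ← map_star, star_pow_mul_level,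
    ← mul_assoc, pow_mul_level]

/-- The span of the monomials `e_k(a) t ^ m (t*) ^ n` of degree `m - n = j`. -/
def gradedPart (j : ℤ) : Submodule ℂ E :=
  Submodule.span ℂ {x | ∃ (k : ℕ) (a : A) (m n : ℕ), (m : ℤ) - n = j ∧
    x = h.level k a * t ^ m * star t ^ n}

/-- The span of the monomials `e_k(a) t ^ m (t*) ^ n` of degree at most `J` in absolute value. -/
def filtration (J : ℕ) : Submodule ℂ E :=
  Submodule.span ℂ {x | ∃ (k : ℕ) (a : A) (m n : ℕ), |(m : ℤ) - n| ≤ J ∧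
    x = h.level k a * t ^ m * star t ^ n}

lemma mul_mem_gradedPart {i j : ℤ} {x y : E} (hx : x ∈ h.gradedPart i) (hy : y ∈ h.gradedPart j) :
    x * y ∈ h.gradedPart (i + j) := by
  have : h.gradedPart i * h.gradedPart j ≤ h.gradedPart (i + j) := by
    rw [gradedPart, gradedPart, Submodule.span_mul_span, Submodule.span_le]
    rintro _ ⟨_, ⟨k, a, m, n, rfl, rfl⟩, _, ⟨l, b, p, q, rfl, rfl⟩, rfl⟩
    obtain ⟨r, c, m', n', hd, he⟩ := h.monomial_mul_monomial k m n l p q a b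
    exact Submodule.subset_span ⟨r, c, m', n', hd, he⟩
  exact this (Submodule.mul_mem_mul hx hy)

lemma star_mem_gradedPart {j : ℤ} {x : E} (hx : x ∈ h.gradedPart j) :
    star x ∈ h.gradedPart (-j) := by
  induction hx using Submodule.span_induction with
  | mem x hx =>
    obtain ⟨k, a, m, n, rfl, rfl⟩ := hx
    obtain ⟨r, c, he⟩ := h.star_monomial k m n a
    exact Submodule.subset_span ⟨r, c, n, m, by ring, he⟩
  | zero => rw [star_zero]; exact zero_mem _
  | add x y _ _ hx hy => rw [star_add]; exact add_mem hx hy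
  | smul c x _ hx => rw [star_smul]; exact Submodule.smul_mem _ _ hx

lemma filtration_mono {J K : ℕ} (hJK : J ≤ K) : h.filtration J ≤ h.filtration K := by
  refine Submodule.span_mono ?_
  rintro _ ⟨k, a, m, n, hd, rfl⟩
  exact ⟨k, a, m, n, hd.trans (by exact_mod_cast hJK), rfl⟩

lemma mul_mem_filtration {J K : ℕ} {x y : E} (hx : x ∈ h.filtration J) (hy : y ∈ h.filtration K) :
    x * y ∈ h.filtration (J + K) := by
  have : h.filtration J * h.filtration K ≤ h.filtration (J + K) := by
    rw [filtration, filtration, Submodule.span_mul_span, Submodule.span_le]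
    rintro _ ⟨_, ⟨k, a, m, n, hmn, rfl⟩, _, ⟨l, b, p, q, hpq, rfl⟩, rfl⟩
    obtain ⟨r, c, m', n', hd, he⟩ := h.monomial_mul_monomial k m n l p q a b
    refine Submodule.subset_span ⟨r, c, m', n', ?_, he⟩
    rw [hd]
    push_cast
    exact (abs_add_le _ _).trans (add_le_add hmn hpq)
  exact this (Submodule.mul_mem_mul hx hy)

lemma pow_mem_filtration {J : ℕ} {x : E} (hx : x ∈ h.filtration J) (n : ℕ) :
    x ^ n ∈ h.filtration (n * J) := by
  induction n with
  | zero =>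
    refine Submodule.subset_span ⟨0, 1, 0, 0, by simp, by simp⟩
  | succ n ih =>
    rw [pow_succ, Nat.succ_mul]
    exact h.mul_mem_filtration ih hx

lemma star_mem_filtration {J : ℕ} {x : E} (hx : x ∈ h.filtration J) :
    star x ∈ h.filtration J := by
  induction hx using Submodule.span_induction with
  | mem x hx =>
    obtain ⟨k, a, m, n, hd, rfl⟩ := hx
    obtain ⟨r, c, he⟩ := h.star_monomial k m n a
    exact Submodule.subset_span ⟨r, c, n, m, by rwa [abs_sub_comm], he⟩
  | zero => rw [star_zero]; exact zero_mem _
  | add x y _ _ hx hy => rw [star_add]; exact add_mem hx hy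
  | smul c x _ hx => rw [star_smul]; exact Submodule.smul_mem _ _ hx

lemma exists_mem_filtration {x : E} (hx : x ∈ StarAlgebra.adjoin ℂ (Set.range ι ∪ {t})) :
    ∃ J, x ∈ h.filtration J := by
  have hι : ∀ a, ι a ∈ h.filtration 0 := fun a =>
    Submodule.subset_span ⟨0, a, 0, 0, by simp, by simp [level_zero]⟩
  induction hx using StarAlgebra.adjoin_induction with
  | mem x hx =>
    rcases hx with ⟨a, rfl⟩ | rfl
    · exact ⟨0, hι a⟩
    · exact ⟨1, Submodule.subset_span ⟨0, 1, 1, 0, by simp, by simp⟩⟩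
  | algebraMap c => exact ⟨0, by simpa only [AlgHomClass.commutes] using hι (algebraMap ℂ A c)⟩
  | add x y _ _ hx hy =>
    obtain ⟨J, hJ⟩ := hx
    obtain ⟨K, hK⟩ := hy
    exact ⟨J + K, add_mem (h.filtration_mono (Nat.le_add_right J K) hJ)
      (h.filtration_mono (Nat.le_add_left K J) hK)⟩
  | mul x y _ _ hx hy =>
    obtain ⟨J, hJ⟩ := hx
    obtain ⟨K, hK⟩ := hy
    exact ⟨J + K, h.mul_mem_filtration hJ hK⟩
  | star x _ hx =>
    obtain ⟨J, hJ⟩ := hx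
    exact ⟨J, h.star_mem_filtration hJ⟩

lemma exists_sum_gradedPart {J : ℕ} {x : E} (hx : x ∈ h.filtration J) :
    ∃ f : ℤ → E, (∀ j, f j ∈ h.gradedPart j) ∧ x = ∑ j ∈ Finset.Icc (-J : ℤ) J, f j := by
  induction hx using Submodule.span_induction with
  | mem x hx =>
    obtain ⟨k, a, m, n, hd, rfl⟩ := hx
    refine ⟨Pi.single ((m : ℤ) - n) (h.level k a * t ^ m * star t ^ n), fun j => ?_, ?_⟩
    · by_cases hj : j = (m : ℤ) - n
      · subst hj
        rw [Pi.single_eq_same]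
        exact Submodule.subset_span ⟨k, a, m, n, rfl, rfl⟩
      · rw [Pi.single_eq_of_ne hj]
        exact zero_mem _
    · rw [Finset.sum_eq_single ((m : ℤ) - n) (fun j _ hj => Pi.single_eq_of_ne hj _)
        (fun hn => absurd (Finset.mem_Icc.mpr (abs_le.mp hd)) hn), Pi.single_eq_same]
  | zero => exact ⟨0, fun j => zero_mem _, by simp⟩
  | add x y _ _ hx hy =>
    obtain ⟨f, hf, rfl⟩ := hx
    obtain ⟨g, hg, rfl⟩ := hy
    exact ⟨f + g, fun j => add_mem (hf j) (hg j), by simp [Finset.sum_add_distrib]⟩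
  | smul c x _ hx =>
    obtain ⟨f, hf, rfl⟩ := hx
    exact ⟨c • f, fun j => Submodule.smul_mem _ _ (hf j), by simp [Finset.smul_sum]⟩

lemma exists_finsupp_of_mem_gradedPart_zero {x : E} (hx : x ∈ h.gradedPart 0) :
    ∃ (k : ℕ) (f : ℕ →₀ A), x = f.sum fun m a => h.level k a * (t ^ m * star t ^ m) := by
  have raise : ∀ (k j : ℕ) (f : ℕ →₀ A),
      (f.sum fun m a => h.level k a * (t ^ m * star t ^ m)) =
        (f.mapRange (α ^ j) (map_zero _)).sum
          fun m a => h.level (k + j) a * (t ^ m * star t ^ m) := by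
    intro k j f
    rw [Finsupp.sum_mapRange_index (by simp)]
    simp only [level_add_apply]
  induction hx using Submodule.span_induction with
  | mem x hx =>
    obtain ⟨k, a, m, n, hd, rfl⟩ := hx
    obtain rfl : m = n := by omega
    exact ⟨k, Finsupp.single m a, by rw [Finsupp.sum_single_index (by simp), mul_assoc]⟩
  | zero => exact ⟨0, 0, by simp⟩
  | add x y _ _ hx hy =>
    obtain ⟨k, f, rfl⟩ := hx
    obtain ⟨l, g, rfl⟩ := hy
    refine ⟨k + l, f.mapRange (α ^ l) (map_zero _) + g.mapRange (α ^ k) (map_zero _), ?_⟩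
    rw [Finsupp.sum_add_index' (by simp) (by simp [add_mul]), raise k l, raise l k, add_comm l k]
  | smul c x _ hx =>
    obtain ⟨k, f, rfl⟩ := hx
    refine ⟨k, c • f, ?_⟩
    rw [Finsupp.sum_smul_index' (by simp), Finsupp.smul_sum]
    simp

/-- The norm of `∑ e_k(f_m) t ^ m (t*) ^ m` is at most the supremum of the norms of the partial sums
`f_0 + ⋯ + f_l`, which are the values of the sum between consecutive range projections. -/
lemma norm_finsupp_sum_le (k : ℕ) (f : ℕ →₀ A) {c : ℝ} (hc0 : 0 ≤ c)
    (hf : ∀ l, ‖∑ m ∈ Finset.range (l + 1), f m‖ ≤ c) :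
    ‖f.sum fun m a => h.level k a * (t ^ m * star t ^ m)‖ ≤ c := by
  obtain ⟨N, hN⟩ : ∃ N, f.support ⊆ Finset.range N := f.support.exists_nat_subset_range
  -- cutting the projections off at `N` absorbs the boundary term of the summation by parts
  set Q : ℕ → E := fun m => if m < N then t ^ m * star t ^ m else 0 with hQdef
  have hQsa : ∀ m, star (Q m) = Q m := fun m => by
    by_cases hm : m < N <;> simp [hQdef, hm]
  have hQ : ∀ i j, i ≤ j → Q i * Q j = Q j := fun i j hij => by
    by_cases hj : j < N
    · simp only [hQdef, if_pos hj, if_pos (hij.trans_lt hj), h.range_mul_range hij]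
    · simp [hQdef, hj]
  have hQc : ∀ m a, Commute (Q m) (h.level k a) := fun m a => by
    by_cases hm : m < N
    · simpa only [hQdef, if_pos hm] using h.commute_level k m a
    · simp [hQdef, hm]
  have abel_sum : ∀ n, ∑ m ∈ Finset.range n, h.level k (f m) * Q m =
      (∑ j ∈ Finset.range n,
        h.level k (∑ m ∈ Finset.range (j + 1), f m) * (Q j - Q (j + 1))) +
        h.level k (∑ m ∈ Finset.range n, f m) * Q n := by
    intro n
    induction n with
    | zero => simp
    | succ n ih =>
      rw [Finset.sum_range_succ, ih, Finset.sum_range_succ _ n, mul_sub,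
        Finset.sum_range_succ (fun m => f m) n, map_add, add_mul, add_mul]
      abel
  have hsum : (f.sum fun m a => h.level k a * (t ^ m * star t ^ m)) =
      ∑ j : Fin N, h.level k (∑ m ∈ Finset.range (j + 1), f m) * (Q j - Q (j + 1)) := by
    rw [Finsupp.sum_of_support_subset f hN _ (by simp)]
    rw [Fin.sum_univ_eq_sum_range
      (fun j => h.level k (∑ m ∈ Finset.range (j + 1), f m) * (Q j - Q (j + 1))) N]
    have hQN : Q N = 0 := by simp [hQdef]
    have := abel_sum N
    rw [hQN, mul_zero, add_zero] at this
    rw [← this]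
    refine Finset.sum_congr rfl fun m hm => ?_
    simp only [hQdef, if_pos (Finset.mem_range.mp hm)]
  rw [hsum]
  exact norm_sum_mul_sub_le (h.level k) Q hQsa hQ hQc N
    (fun j => ∑ m ∈ Finset.range (j + 1), f m) hc0 hf

end IsCovariantPair

end CovariantPair

/-! ### The shift on `ℓ²(ℤ, H)` and its compression -/

section Shift

variable {H : Type w} [NormedAddCommGroup H] [InnerProductSpace ℂ H] [CompleteSpace H]

lemma shift_single (n : ℤ) (v : H) :
    shift H (lp.single 2 n v) = lp.single 2 (n + 1) v := by
  ext k
  rw [shift_apply, lp.single_apply, lp.single_apply]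
  by_cases hk : k = n + 1
  · subst hk
    rw [Pi.single_eq_same, add_sub_cancel_right, Pi.single_eq_same]
  · rw [Pi.single_eq_of_ne hk, Pi.single_eq_of_ne (by omega)]

lemma star_shift_apply (ξ : L2Z H) (n : ℤ) : (star (shift H) ξ : L2Z H) n = ξ (n + 1) := by
  refine ext_inner_left ℂ fun v => ?_
  rw [← lp.inner_single_left n v (star (shift H) ξ), ContinuousLinearMap.star_eq_adjoint,
    ContinuousLinearMap.adjoint_inner_right, shift_single, lp.inner_single_left]

lemma star_shift_mul_shift : star (shift H) * shift H = 1 := by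
  ext ξ n
  rw [mul_apply_eq_comp, star_shift_apply, shift_apply, add_sub_cancel_right]
  rfl

lemma shift_mul_star_shift : shift H * star (shift H) = 1 := by
  ext ξ n
  rw [mul_apply_eq_comp, shift_apply, star_shift_apply, sub_add_cancel]
  rfl

lemma posIncl_apply_of_neg (ξ : PosSpace H) {n : ℤ} (hn : n < 0) : posIncl H ξ n = 0 := by
  rw [← posProj_posIncl, posProj_apply, if_neg hn.not_ge]

lemma posSpace_ext {ξ η : PosSpace H} (h : ∀ n : ℕ, posIncl H ξ n = posIncl H η n) : ξ = η := by
  refine posIncl_injective (lp.ext (funext fun n => ?_))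
  rcases lt_or_ge n 0 with hn | hn
  · rw [posIncl_apply_of_neg _ hn, posIncl_apply_of_neg _ hn]
  · lift n to ℕ using hn
    exact h n

lemma posIncl_compress_shift (ξ : PosSpace H) :
    posIncl H (compress (shift H) ξ) = shift H (posIncl H ξ) := by
  ext n
  rw [posIncl_compress, posProj_apply, shift_apply]
  split_ifs with hn
  · rfl
  · rw [posIncl_apply_of_neg _ (by omega)]

lemma posIncl_compress_shift_pow_apply (m : ℕ) (ξ : PosSpace H) (n : ℤ) :
    posIncl H ((compress (shift H) ^ m) ξ) n = posIncl H ξ (n - m) := by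
  induction m generalizing n with
  | zero => simp
  | succ m ih =>
    rw [pow_succ', mul_apply_eq_comp, posIncl_compress_shift, shift_apply, ih,
      show n - 1 - (m : ℤ) = n - ((m + 1 : ℕ) : ℤ) by push_cast; ring]

lemma posIncl_star_compress_shift_apply (ξ : PosSpace H) {n : ℤ} (hn : 0 ≤ n) :
    posIncl H (star (compress (shift H)) ξ) n = posIncl H ξ (n + 1) := by
  rw [← compress_star, posIncl_compress, posProj_apply, if_pos hn, star_shift_apply]

lemma posIncl_star_compress_shift_pow_apply (m : ℕ) (ξ : PosSpace H) {n : ℤ} (hn : 0 ≤ n) :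
    posIncl H ((star (compress (shift H)) ^ m) ξ) n = posIncl H ξ (n + m) := by
  induction m generalizing n with
  | zero => simp
  | succ m ih =>
    rw [pow_succ', mul_apply_eq_comp, posIncl_star_compress_shift_apply _ hn, ih (by omega),
      show n + 1 + (m : ℤ) = n + ((m + 1 : ℕ) : ℤ) by push_cast; ring]

lemma compress_mul_shift (x : L2Z H →L[ℂ] L2Z H) :
    compress (x * shift H) = compress x * compress (shift H) := by
  ext1 ξ
  apply posIncl_injective
  rw [mul_apply_eq_comp, posIncl_compress, posIncl_compress, posIncl_compress_shift,
    mul_apply_eq_comp]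

lemma compress_one : compress (1 : L2Z H →L[ℂ] L2Z H) = 1 := by
  ext1 ξ
  exact posIncl_injective (posProj_posIncl ξ)

lemma compress_shift_pow (n : ℕ) : compress (shift H ^ n) = compress (shift H) ^ n := by
  induction n with
  | zero => rw [pow_zero, pow_zero, compress_one]
  | succ n ih => rw [pow_succ, pow_succ, compress_mul_shift, ih]

lemma compress_star_shift_pow (n : ℕ) :
    compress (star (shift H) ^ n) = star (compress (shift H)) ^ n := by
  rw [← star_pow, compress_star, compress_shift_pow, star_pow]

variable (H) in
/-- The compression to `p ℓ²(ℤ, H)`, as a continuous linear map. -/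
def compressL : (L2Z H →L[ℂ] L2Z H) →L[ℂ] (PosSpace H →L[ℂ] PosSpace H) :=
  (ContinuousLinearMap.compL ℂ (PosSpace H) (L2Z H) (PosSpace H) (posRestrict H)).comp
    ((ContinuousLinearMap.compL ℂ (PosSpace H) (L2Z H) (L2Z H)).flip (posIncl H))

/-- The diagonal matrix entry at position `l` of an operator on `p ℓ²(ℤ, H)`. -/
def diagEntry (l : ℕ) : (PosSpace H →L[ℂ] PosSpace H) →ₗ[ℂ] (H →L[ℂ] H) where
  toFun x := (lp.evalCLM ℂ (fun _ : ℤ => H) 2 (l : ℤ)).comp ((posIncl H).comp (x.comp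
    ((posRestrict H).comp (lp.singleContinuousLinearMap ℂ (fun _ : ℤ => H) 2 (l : ℤ)))))
  map_add' _ _ := by ext; simp
  map_smul' _ _ := by ext; simp

lemma diagEntry_apply (l : ℕ) (x : PosSpace H →L[ℂ] PosSpace H) (v : H) :
    diagEntry l x v = posIncl H (x (posRestrict H (lp.single 2 (l : ℤ) v))) l := rfl

lemma posIncl_posRestrict_single (l : ℕ) (v : H) :
    posIncl H (posRestrict H (lp.single 2 (l : ℤ) v)) = lp.single 2 (l : ℤ) v := by
  rw [posIncl_posRestrict]
  ext n
  rw [posProj_apply]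
  split_ifs with hn
  · rfl
  · rw [lp.single_apply, Pi.single_eq_of_ne (by omega)]

lemma norm_posIncl (ξ : PosSpace H) : ‖posIncl H ξ‖ = ‖ξ‖ := rfl

lemma norm_diagEntry_le (l : ℕ) (x : PosSpace H →L[ℂ] PosSpace H) : ‖diagEntry l x‖ ≤ ‖x‖ := by
  refine ContinuousLinearMap.opNorm_le_bound _ (norm_nonneg x) fun v => ?_
  rw [diagEntry_apply]
  refine (lp.norm_apply_le_norm (by norm_num) _ _).trans ?_
  rw [norm_posIncl]
  refine (x.le_opNorm _).trans_eq ?_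
  rw [← norm_posIncl, posIncl_posRestrict_single, lp.norm_single (by norm_num)]

end Shift

/-! ### The compressed regular representation -/

section Regular

variable {B : Type u} [CStarAlgebra B] {H : Type w} [NormedAddCommGroup H]
  [InnerProductSpace ℂ H] [CompleteSpace H] (β : B ≃⋆ₐ[ℂ] B) (π : B →⋆ₐ[ℂ] (H →L[ℂ] H))

lemma posIncl_posRep_apply (b : B) (ξ : PosSpace H) (n : ℤ) :
    posIncl H (posRep β π b ξ) n = π ((β ^ (-n)) b) (posIncl H ξ n) := by
  change posIncl H (compress (inducedRep β π b) ξ) n = _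
  rw [posIncl_compress, ← inducedRep_posProj, posProj_posIncl, inducedRep_apply]

lemma compress_inducedRep_mul (b : B) (x : L2Z H →L[ℂ] L2Z H) :
    compress (inducedRep β π b * x) = posRep β π b * compress x := by
  ext1 ξ
  apply posIncl_injective
  change _ = posIncl H (compress (inducedRep β π b) (compress x ξ))
  rw [posIncl_compress, posIncl_compress, mul_apply_eq_comp, posIncl_compress, inducedRep_posProj,
    posProj_posProj]

lemma zpow_neg_add_one_apply (n : ℤ) (b : B) : (β ^ (-n)) (β b) = (β ^ (-(n - 1))) b := by
  rw [neg_sub, sub_eq_neg_add, zpow_add_one]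
  rfl

lemma shift_mul_inducedRep (b : B) :
    shift H * inducedRep β π b = inducedRep β π (β b) * shift H := by
  ext ξ n
  rw [mul_apply_eq_comp, mul_apply_eq_comp, shift_apply, inducedRep_apply, inducedRep_apply,
    shift_apply, zpow_neg_add_one_apply]

lemma star_shift_mul_inducedRep (b : B) :
    star (shift H) * inducedRep β π b = inducedRep β π (β.symm b) * star (shift H) := by
  have h := shift_mul_inducedRep β π (β.symm b)
  rw [StarAlgEquiv.apply_symm_apply] at h
  calc star (shift H) * inducedRep β π b
      = star (shift H) * (inducedRep β π b * shift H) * star (shift H) := by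
        rw [mul_assoc, mul_assoc, shift_mul_star_shift, mul_one]
    _ = inducedRep β π (β.symm b) * star (shift H) := by
        rw [← h, ← mul_assoc, star_shift_mul_shift, one_mul]

lemma isCovariantPair_posRep :
    IsCovariantPair (β : B →⋆ₐ[ℂ] B) (posRep β π) (compress (shift H)) where
  isometry := by
    ext1 ξ
    refine posSpace_ext fun n => ?_
    rw [mul_apply_eq_comp, posIncl_star_compress_shift_apply _ (by omega), posIncl_compress_shift,
      shift_apply, add_sub_cancel_right]
    rfl
  covariant b := by
    ext1 ξ
    refine posSpace_ext fun n => ?_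
    rw [mul_apply_eq_comp, mul_apply_eq_comp, posIncl_posRep_apply, posIncl_compress_shift,
      posIncl_compress_shift, shift_apply, shift_apply, posIncl_posRep_apply,
      ← zpow_neg_add_one_apply]
    rfl
  commute k b := by
    ext1 ξ
    refine posSpace_ext fun n => ?_
    simp only [mul_apply_eq_comp, posIncl_posRep_apply, posIncl_compress_shift_pow_apply]
    rcases lt_or_ge ((n : ℤ) - k) 0 with hn | hn
    · rw [posIncl_apply_of_neg _ hn, posIncl_apply_of_neg _ hn, map_zero]
    · rw [posIncl_star_compress_shift_pow_apply _ _ hn, posIncl_star_compress_shift_pow_apply _ _ hn,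
        posIncl_posRep_apply, sub_add_cancel]

lemma diagEntry_monomial (l m n : ℕ) (b : B) :
    diagEntry l (posRep β π b * compress (shift H) ^ m * star (compress (shift H)) ^ n) =
      if m = n ∧ m ≤ l then π ((β ^ (-(l : ℤ))) b) else 0 := by
  ext v
  rw [diagEntry_apply, mul_apply_eq_comp, mul_apply_eq_comp, posIncl_posRep_apply,
    posIncl_compress_shift_pow_apply]
  by_cases hml : m ≤ l
  · rw [posIncl_star_compress_shift_pow_apply _ _ (by omega), posIncl_posRestrict_single,
      lp.single_apply]
    by_cases hmn : m = n
    · subst hmn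
      rw [sub_add_cancel, Pi.single_eq_same, if_pos ⟨rfl, hml⟩]
    · rw [Pi.single_eq_of_ne (by omega), map_zero, if_neg (fun h => hmn h.1)]
      rfl
  · rw [posIncl_apply_of_neg _ (by omega), map_zero, if_neg (fun h => hml h.2)]
    rfl

/-- Left multiplication by the generators preserves the span of the `π̃(b) U ^ n` and
`π̃(b) (U*) ^ n`, so this span contains the `*`-algebra that they generate. -/
lemma adjoin_le_span_inducedRep_mul {x : L2Z H →L[ℂ] L2Z H}
    (hx : x ∈ StarAlgebra.adjoin ℂ (Set.range (inducedRep β π) ∪ {shift H})) :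
    x ∈ Submodule.span ℂ {y | ∃ (b : B) (n : ℕ), y = inducedRep β π b * shift H ^ n ∨
      y = inducedRep β π b * star (shift H) ^ n} := by
  set V := Submodule.span ℂ {y | ∃ (b : B) (n : ℕ), y = inducedRep β π b * shift H ^ n ∨
      y = inducedRep β π b * star (shift H) ^ n} with hV
  have hpow : ∀ b n, inducedRep β π b * shift H ^ n ∈ V := fun b n =>
    Submodule.subset_span ⟨b, n, Or.inl rfl⟩
  have hspow : ∀ b n, inducedRep β π b * star (shift H) ^ n ∈ V := fun b n =>
    Submodule.subset_span ⟨b, n, Or.inr rfl⟩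
  have of_gen : ∀ g : L2Z H →L[ℂ] L2Z H,
      (∀ b n, g * (inducedRep β π b * shift H ^ n) ∈ V) →
      (∀ b n, g * (inducedRep β π b * star (shift H) ^ n) ∈ V) → ∀ y ∈ V, g * y ∈ V := by
    intro g h1 h2 y hy
    induction hy using Submodule.span_induction with
    | mem y hy =>
      obtain ⟨b, n, rfl | rfl⟩ := hy
      · exact h1 b n
      · exact h2 b n
    | zero => rw [mul_zero]; exact zero_mem _
    | add y z _ _ hy hz => rw [mul_add]; exact add_mem hy hz
    | smul c y _ hy => rw [mul_smul_comm]; exact Submodule.smul_mem _ _ hy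
  have hind : ∀ b, ∀ y ∈ V, inducedRep β π b * y ∈ V := fun b =>
    of_gen _ (fun c n => by rw [← mul_assoc, ← map_mul]; exact hpow _ _)
      (fun c n => by rw [← mul_assoc, ← map_mul]; exact hspow _ _)
  have hshift : ∀ y ∈ V, shift H * y ∈ V := by
    refine of_gen _ (fun c n => ?_) (fun c n => ?_)
    · rw [← mul_assoc, shift_mul_inducedRep, mul_assoc, ← pow_succ']
      exact hpow _ _
    · rw [← mul_assoc, shift_mul_inducedRep, mul_assoc]
      cases n with
      | zero => simpa using hpow (β c) 1
      | succ n =>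
        rw [pow_succ', ← mul_assoc (shift H), shift_mul_star_shift, one_mul]
        exact hspow _ _
  have hstar : ∀ y ∈ V, star (shift H) * y ∈ V := by
    refine of_gen _ (fun c n => ?_) (fun c n => ?_)
    · rw [← mul_assoc, star_shift_mul_inducedRep, mul_assoc]
      cases n with
      | zero => simpa using hspow (β.symm c) 1
      | succ n =>
        rw [pow_succ', ← mul_assoc (star (shift H)), star_shift_mul_shift, one_mul]
        exact hpow _ _
    · rw [← mul_assoc, star_shift_mul_inducedRep, mul_assoc, ← pow_succ']
      exact hspow _ _
  have hmain : ∀ y ∈ V, x * y ∈ V := by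
    rw [← StarSubalgebra.mem_toSubalgebra, StarAlgebra.adjoin_toSubalgebra] at hx
    induction hx using Algebra.adjoin_induction with
    | mem z hz =>
      rcases hz with (⟨b, rfl⟩ | rfl) | hz
      · exact hind b
      · exact hshift
      · rcases hz with ⟨b, hb⟩ | hz
        · have : z = inducedRep β π (star b) := by rw [map_star, hb, star_star]
          rw [this]
          exact hind _
        · have : z = star (shift H) := by rw [← Set.mem_singleton_iff.mp hz, star_star]
          rw [this]
          exact hstar
    | algebraMap c =>
      intro y hy
      rw [← Algebra.smul_def]
      exact Submodule.smul_mem _ _ hy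
    | add z z' _ _ hz hz' => intro y hy; rw [add_mul]; exact add_mem (hz y hy) (hz' y hy)
    | mul z z' _ _ hz hz' => intro y hy; rw [mul_assoc]; exact hz _ (hz' y hy)
  have h1 : (1 : L2Z H →L[ℂ] L2Z H) ∈ V := by simpa using hpow 1 0
  simpa using hmain 1 h1

end Regular

/-! ### The concrete crossed product -/

section Concrete

variable {A : Type u} [CStarAlgebra A] (α : A →⋆ₐ[ℂ] A) (hα : Function.Injective α)

lemma isCovariantPair_concrete :
    IsCovariantPair α (concreteRep α hα) (concreteIsometry α hα) := by
  have h := isCovariantPair_posRep (limitAut α hα) (universalRep (Limit α hα))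
  refine ⟨h.isometry, fun a => ?_, fun k a => h.commute k _⟩
  rw [concreteRep, StarAlgHom.comp_apply, StarAlgHom.comp_apply, ← limitAut_limitMap]
  exact h.covariant (limitMap α hα 0 a)

lemma concrete_level (k : ℕ) (a : A) : (isCovariantPair_concrete α hα).level k a =
    posRep (limitAut α hα) (universalRep (Limit α hα)) (limitMap α hα k a) := by
  set h := isCovariantPair_concrete α hα
  induction k generalizing a with
  | zero => exact h.level_zero a
  | succ k ih =>
    have hp := isCovariantPair_posRep (limitAut α hα) (universalRep (Limit α hα))
    have h1 : posRep (limitAut α hα) (universalRep (Limit α hα))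
        (limitAut α hα (limitMap α hα (k + 1) a)) * concreteIsometry α hα = _ :=
      hp.covariant (limitMap α hα (k + 1) a)
    rw [limitAut_limitMap, limitMap_succ, ← ih] at h1
    have h2 := (h.level_mul k a).symm.trans h1
    have h3 := congrArg (star (concreteIsometry α hα) * ·) h2
    rw [← mul_assoc, h.isometry, one_mul] at h3
    refine h3.trans ?_
    change star (concreteIsometry α hα) * (concreteIsometry α hα * _) = _
    rw [← mul_assoc, h.isometry, one_mul]

lemma norm_limitMap (k : ℕ) (a : A) : ‖limitMap α hα k a‖ = ‖a‖ :=
  UniformSpace.Completion.norm_coe (PreLimit.mk α hα k a)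

lemma concreteRep_injective : Function.Injective (concreteRep α hα) := by
  refine (injective_iff_map_eq_zero _).mpr fun a ha => ?_
  have h := diagEntry_monomial (limitAut α hα) (universalRep (Limit α hα)) 0 0 0
    (limitMap α hα 0 a)
  have ha' : posRep (limitAut α hα) (universalRep (Limit α hα)) (limitMap α hα 0 a) = 0 := ha
  rw [ha', zero_mul, zero_mul, map_zero, if_pos ⟨rfl, le_rfl⟩] at h
  have h2 := (map_eq_zero_iff _ universalRep_injective).mp h.symm
  have h3 : limitMap α hα 0 a = 0 := h2
  rw [← norm_eq_zero, ← norm_limitMap α hα 0 a, h3, norm_zero]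

lemma posRep_mem_concreteAlgebra (x : Limit α hα) :
    posRep (limitAut α hα) (universalRep (Limit α hα)) x ∈ concreteAlgebra α hα := by
  induction x using UniformSpace.Completion.induction_on with
  | hp =>
    have hc : Continuous (posRep (limitAut α hα) (universalRep (Limit α hα))) :=
      AddMonoidHomClass.continuous_of_bound _ 1 fun x =>
        (NonUnitalStarAlgHom.norm_apply_le _ x).trans_eq (one_mul _).symm
    exact (StarSubalgebra.isClosed_topologicalClosure _).preimage hc
  | ih x =>
    induction x using PreLimit.induction with
    | h n a =>
      have hmem : (isCovariantPair_concrete α hα).level n a ∈ concreteAlgebra α hα :=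
        mul_mem (mul_mem (pow_mem (star_mem (concreteIsometry_mem α hα)) n)
          (concreteRep_mem α hα a)) (pow_mem (concreteIsometry_mem α hα) n)
      rw [concrete_level] at hmem
      exact hmem

lemma compress_mem_concreteAlgebra {x : L2Z (HU α hα) →L[ℂ] L2Z (HU α hα)}
    (hx : x ∈ crossedProductZ (limitAut α hα)) : compress x ∈ concreteAlgebra α hα := by
  have hclosed : IsClosed {x | compress x ∈ concreteAlgebra α hα} :=
    (StarSubalgebra.isClosed_topologicalClosure _).preimage (compressL (HU α hα)).continuous
  refine closure_minimal (fun y hy => ?_) hclosed hx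
  refine Submodule.span_le (p := (concreteAlgebra α hα).toSubalgebra.toSubmodule.comap
    (compressL (HU α hα)).toLinearMap).mpr ?_ (adjoin_le_span_inducedRep_mul _ _ hy)
  rintro _ ⟨b, n, rfl | rfl⟩
  · change compress _ ∈ concreteAlgebra α hα
    rw [compress_inducedRep_mul, compress_shift_pow]
    exact mul_mem (posRep_mem_concreteAlgebra α hα b) (pow_mem (concreteIsometry_mem α hα) n)
  · change compress _ ∈ concreteAlgebra α hα
    rw [compress_inducedRep_mul, compress_star_shift_pow]
    exact mul_mem (posRep_mem_concreteAlgebra α hα b)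
      (pow_mem (star_mem (concreteIsometry_mem α hα)) n)

lemma concreteAlgebra_eq_adjoin_compress : concreteAlgebra α hα =
    (StarAlgebra.adjoin ℂ (compress '' (crossedProductZ (limitAut α hα) :
      Set (L2Z (HU α hα) →L[ℂ] L2Z (HU α hα))))).topologicalClosure := by
  refine le_antisymm (StarSubalgebra.topologicalClosure_mono (StarAlgebra.adjoin_mono ?_))
    (StarSubalgebra.topologicalClosure_minimal (StarAlgebra.adjoin_le ?_)
      (StarSubalgebra.isClosed_topologicalClosure _))
  · have hsub := (StarAlgebra.subset_adjoin ℂ (Set.range (inducedRep (limitAut α hα)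
      (universalRep (Limit α hα))) ∪ {shift (HU α hα)})).trans
      (StarSubalgebra.le_topologicalClosure _)
    rintro _ (⟨a, rfl⟩ | rfl)
    · exact ⟨_, hsub (Or.inl ⟨limitMap α hα 0 a, rfl⟩), rfl⟩
    · exact ⟨_, hsub (Or.inr rfl), rfl⟩
  · rintro _ ⟨x, hx, rfl⟩
    exact compress_mem_concreteAlgebra α hα hx

lemma adjoin_concreteIncl_topologicalClosure : (StarAlgebra.adjoin ℂ
    (Set.range (concreteIncl α hα) ∪ {concreteElement α hα})).topologicalClosure = ⊤ := by
  refine eq_top_iff.mpr fun x _ => ?_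
  change x ∈ closure _
  rw [Topology.IsInducing.subtypeVal.closure_eq_preimage_closure_image]
  refine closure_mono ?_ x.2
  change StarAlgebra.adjoin ℂ _ ≤ (StarAlgebra.adjoin ℂ
    (Set.range (concreteIncl α hα) ∪ {concreteElement α hα})).map (concreteAlgebra α hα).subtype
  refine StarAlgebra.adjoin_le ?_
  rintro _ (⟨a, rfl⟩ | rfl)
  · exact ⟨_, StarAlgebra.subset_adjoin ℂ _ (Or.inl ⟨a, rfl⟩), rfl⟩
  · exact ⟨_, StarAlgebra.subset_adjoin ℂ _ (Or.inr rfl), rfl⟩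

end Concrete

/-! ### Diagonal entries and the comparison of norms in degree zero -/

section Comparison

variable {A : Type u} [CStarAlgebra A]

lemma IsCovariantRep.isCovariantPair {α : A →⋆ₐ[ℂ] A} {H : Type v} [NormedAddCommGroup H]
    [InnerProductSpace ℂ H] [CompleteSpace H] {π : A →⋆ₐ[ℂ] (H →L[ℂ] H)} {W : H →L[ℂ] H}
    (h : IsCovariantRep α π W) : IsCovariantPair α π W where
  isometry := by
    rw [ContinuousLinearMap.star_eq_adjoint]
    exact (ContinuousLinearMap.norm_map_iff_adjoint_comp_self W).mp
      fun x => h.isometry.norm_map_of_map_zero (map_zero W) x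
  covariant := h.covariant
  commute := h.commute

variable {α : A →⋆ₐ[ℂ] A} {hα : Function.Injective α} {E : Type v} [CStarAlgebra E]
  {π : A →⋆ₐ[ℂ] E} {W : E}

variable (hα) in
/-- The covariant pair that consists of the concrete pair on `p ℓ²(ℤ, H_u)` and of a given one. -/
lemma IsCovariantPair.concrete_prod (h : IsCovariantPair α π W) :
    IsCovariantPair α ((concreteRep α hα).prod π) (concreteIsometry α hα, W) :=
  (isCovariantPair_concrete α hα).prod h

lemma IsCovariantPair.concrete_prod_level (h : IsCovariantPair α π W) (k : ℕ) (a : A) :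
    (h.concrete_prod hα).level k a = (posRep (limitAut α hα) (universalRep (Limit α hα))
      (limitMap α hα k a), h.level k a) := by
  rw [← concrete_level]
  rfl

lemma IsCovariantPair.diagEntry_fst_eq_zero (h : IsCovariantPair α π W) {j : ℤ} (hj : j ≠ 0)
    {x : (PosSpace (HU α hα) →L[ℂ] PosSpace (HU α hα)) × E}
    (hx : x ∈ (h.concrete_prod hα).gradedPart j) (l : ℕ) : diagEntry l x.1 = 0 := by
  induction hx using Submodule.span_induction with
  | mem x hx =>
    obtain ⟨k, a, m, n, rfl, rfl⟩ := hx
    rw [h.concrete_prod_level]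
    exact (diagEntry_monomial _ _ l m n _).trans (if_neg fun hmn => hj (by omega))
  | zero => exact map_zero _
  | add x y _ _ hx hy => rw [Prod.fst_add, map_add, hx, hy, add_zero]
  | smul c x _ hx => rw [Prod.smul_fst, map_smul, hx, smul_zero]

/-- In degree zero the diagonal entries in the concrete pair control the norm in any other pair:
the entry at position `l` of `∑ e_k(f_m) t ^ m (t*) ^ m` is a faithful image of
`f_0 + ⋯ + f_l`. -/
lemma IsCovariantPair.norm_snd_le_of_diagEntry (h : IsCovariantPair α π W)
    {x : (PosSpace (HU α hα) →L[ℂ] PosSpace (HU α hα)) × E}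
    (hx : x ∈ (h.concrete_prod hα).gradedPart 0) {c : ℝ} (hc0 : 0 ≤ c)
    (hc : ∀ l, ‖diagEntry l x.1‖ ≤ c) : ‖x.2‖ ≤ c := by
  obtain ⟨k, f, rfl⟩ := (h.concrete_prod hα).exists_finsupp_of_mem_gradedPart_zero hx
  have hsnd : (f.sum fun m a => (h.concrete_prod hα).level k a *
      ((concreteIsometry α hα, W) ^ m * star (concreteIsometry α hα, W) ^ m)).2 =
      f.sum fun m a => h.level k a * (W ^ m * star W ^ m) :=
    map_finsuppSum (StarAlgHom.snd ℂ (PosSpace (HU α hα) →L[ℂ] PosSpace (HU α hα)) E) f _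
  have hfst : (f.sum fun m a => (h.concrete_prod hα).level k a *
      ((concreteIsometry α hα, W) ^ m * star (concreteIsometry α hα, W) ^ m)).1 =
      f.sum fun m a => posRep (limitAut α hα) (universalRep (Limit α hα)) (limitMap α hα k a) *
        compress (shift (HU α hα)) ^ m * star (compress (shift (HU α hα))) ^ m := by
    refine (map_finsuppSum (StarAlgHom.fst ℂ (PosSpace (HU α hα) →L[ℂ] PosSpace (HU α hα)) E)
      f _).trans (Finsupp.sum_congr fun m _ => ?_)
    rw [h.concrete_prod_level, mul_assoc]
    rfl
  rw [hsnd]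
  refine h.norm_finsupp_sum_le k f hc0 fun l => ?_
  have hentry : diagEntry l (f.sum fun m a => posRep (limitAut α hα) (universalRep (Limit α hα))
      (limitMap α hα k a) * compress (shift (HU α hα)) ^ m *
        star (compress (shift (HU α hα))) ^ m) =
      universalRep (Limit α hα) ((limitAut α hα ^ (-(l : ℤ)))
        (limitMap α hα k (∑ m ∈ Finset.range (l + 1), f m))) := by
    obtain ⟨N, hN⟩ : ∃ N, f.support ⊆ Finset.range N := f.support.exists_nat_subset_range
    have hN' : f.support ⊆ Finset.range (N + (l + 1)) :=
      hN.trans (Finset.range_subset_range.mpr (Nat.le_add_right _ _))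
    rw [Finsupp.sum_of_support_subset f hN' _ (by simp), map_sum, map_sum, map_sum, map_sum]
    simp only [diagEntry_monomial, true_and]
    rw [← Finset.sum_filter]
    refine Finset.sum_congr (Finset.ext fun m => ?_) fun _ _ => rfl
    simp only [Finset.mem_filter, Finset.mem_range]
    omega
  have := hc l
  rwa [hfst, hentry, NonUnitalStarAlgHom.norm_map (universalRep (Limit α hα)) universalRep_injective,
    NonUnitalStarAlgHom.norm_map (limitAut α hα ^ (-(l : ℤ))) (EquivLike.injective _),
    norm_limitMap] at this

end Comparison

/-! ### The universal property -/

section Representation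

variable {A : Type u} [CStarAlgebra A] {α : A →⋆ₐ[ℂ] A} {hα : Function.Injective α}
  {H : Type v} [NormedAddCommGroup H] [InnerProductSpace ℂ H] [CompleteSpace H]
  {π : A →⋆ₐ[ℂ] (H →L[ℂ] H)} {W : H →L[ℂ] H}

/-- A first comparison of norms, with a constant that depends on the degree: if `x = ∑ x_j` with
`x_j` of degree `j`, then `∑ x_j* x_j` is the part of degree zero of `x* x`, and it dominates `x* x`
up to the number of summands. -/
lemma IsCovariantPair.sq_norm_snd_le (h : IsCovariantPair α π W) {J : ℕ}
    {x : (PosSpace (HU α hα) →L[ℂ] PosSpace (HU α hα)) × (H →L[ℂ] H)}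
    (hx : x ∈ (h.concrete_prod hα).filtration J) : ‖x.2‖ ^ 2 ≤ (2 * J + 1) * ‖x.1‖ ^ 2 := by
  obtain ⟨f, hf, hxf⟩ := (h.concrete_prod hα).exists_sum_gradedPart hx
  set s := Finset.Icc (-J : ℤ) J with hs
  have hcard : (s.card : ℝ) = 2 * J + 1 := by
    rw [hs, Int.card_Icc]
    have : ((J : ℤ) + 1 - -J).toNat = 2 * J + 1 := by omega
    rw [this]
    push_cast
    ring
  set y := ∑ j ∈ s, star (f j) * f j with hy
  have hmem : ∀ i j, star (f i) * f j ∈ (h.concrete_prod hα).gradedPart (-i + j) := fun i j =>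
    (h.concrete_prod hα).mul_mem_gradedPart ((h.concrete_prod hα).star_mem_gradedPart (hf i)) (hf j)
  have hy0 : y ∈ (h.concrete_prod hα).gradedPart 0 :=
    Submodule.sum_mem _ fun j _ => by simpa using hmem j j
  have hfst : ∀ z : ℤ → (PosSpace (HU α hα) →L[ℂ] PosSpace (HU α hα)) × (H →L[ℂ] H),
      (∑ j ∈ s, z j).1 = ∑ j ∈ s, (z j).1 := fun z => Prod.fst_sum
  have hsnd : ∀ z : ℤ → (PosSpace (HU α hα) →L[ℂ] PosSpace (HU α hα)) × (H →L[ℂ] H),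
      (∑ j ∈ s, z j).2 = ∑ j ∈ s, (z j).2 := fun z => Prod.snd_sum
  have hentry : ∀ l, diagEntry l (star x * x).1 = diagEntry l y.1 := by
    intro l
    have : star x * x = ∑ i ∈ s, ∑ j ∈ s, star (f i) * f j := by
      rw [hxf, star_sum, Finset.sum_mul_sum]
    rw [this, hfst, hy, hfst, map_sum, map_sum]
    refine Finset.sum_congr rfl fun i hi => ?_
    rw [hfst, map_sum]
    exact Finset.sum_eq_single i
      (fun j _ hj => h.diagEntry_fst_eq_zero (by omega) (hmem i j) l) (fun hn => absurd hi hn)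
  have hy2 : ‖y.2‖ ≤ ‖x.1‖ ^ 2 := by
    refine h.norm_snd_le_of_diagEntry hy0 (sq_nonneg _) fun l => ?_
    rw [← hentry]
    refine (norm_diagEntry_le l _).trans_eq ?_
    rw [Prod.fst_mul, Prod.fst_star, CStarRing.norm_star_mul_self, sq]
  have hvec : ∀ ξ : H, ‖x.2 ξ‖ ^ 2 ≤ (2 * J + 1) * ‖x.1‖ ^ 2 * ‖ξ‖ ^ 2 := by
    intro ξ
    have h1 : x.2 ξ = ∑ j ∈ s, (f j).2 ξ := by
      rw [hxf, hsnd, sum_apply]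
    have h2 : ∑ j ∈ s, ‖(f j).2 ξ‖ ^ 2 = (inner ℂ (y.2 ξ) ξ).re := by
      rw [hy, hsnd, sum_apply, sum_inner, Complex.re_sum]
      refine Finset.sum_congr rfl fun j _ => ?_
      rw [Prod.snd_mul, Prod.snd_star, mul_apply_eq_comp, ContinuousLinearMap.star_eq_adjoint,
        ContinuousLinearMap.adjoint_inner_left]
      exact (inner_self_eq_norm_sq (𝕜 := ℂ) _).symm
    have h3 : (inner ℂ (y.2 ξ) ξ).re ≤ ‖x.1‖ ^ 2 * ‖ξ‖ ^ 2 := by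
      refine (Complex.re_le_norm _).trans ((norm_inner_le_norm _ _).trans ?_)
      rw [sq ‖ξ‖, ← mul_assoc]
      gcongr
      exact (y.2.le_opNorm ξ).trans (by gcongr)
    calc ‖x.2 ξ‖ ^ 2 ≤ (∑ j ∈ s, ‖(f j).2 ξ‖) ^ 2 := by
          rw [h1]
          gcongr
          exact norm_sum_le _ _
      _ ≤ s.card * ∑ j ∈ s, ‖(f j).2 ξ‖ ^ 2 := sq_sum_le_card_mul_sum_sq
      _ ≤ (2 * J + 1) * (‖x.1‖ ^ 2 * ‖ξ‖ ^ 2) := by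
          rw [hcard, h2]
          gcongr
      _ = _ := by ring
  have hC : 0 ≤ (2 * J + 1) * ‖x.1‖ ^ 2 := by positivity
  have hle : ‖x.2‖ ≤ √((2 * J + 1) * ‖x.1‖ ^ 2) := by
    refine ContinuousLinearMap.opNorm_le_bound _ (Real.sqrt_nonneg _) fun ξ => ?_
    refine le_of_pow_le_pow_left₀ two_ne_zero (by positivity) ?_
    rw [mul_pow, Real.sq_sqrt hC]
    exact hvec ξ
  calc ‖x.2‖ ^ 2 ≤ √((2 * J + 1) * ‖x.1‖ ^ 2) ^ 2 := by gcongr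
    _ = _ := Real.sq_sqrt hC

/-- Constants of linear growth disappear on passing to roots of high order. -/
lemma le_of_forall_pow_le_linear_mul_pow {a b : ℝ} (hb : 0 ≤ b) (C : ℝ)
    (h : ∀ n : ℕ, a ^ (2 ^ n) ≤ (C * 2 ^ n + 1) * b ^ (2 ^ n)) : a ≤ b := by
  by_contra! hlt
  rcases hb.eq_or_lt with rfl | hb
  · have := h 0
    simp only [pow_zero, pow_one, mul_zero] at this
    exact hlt.not_ge this
  have hr : 1 < a / b := (one_lt_div hb).mpr hlt
  have hlim : Filter.Tendsto (fun n : ℕ => (C * (n : ℝ) + 1) / (a / b) ^ n) Filter.atTop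
      (nhds 0) := by
    have h1 := (tendsto_pow_const_div_const_pow_of_one_lt 1 hr).const_mul C
    have h0 := tendsto_pow_const_div_const_pow_of_one_lt 0 hr
    have := h1.add h0
    simp only [mul_zero, add_zero] at this
    refine this.congr fun n => ?_
    simp only [pow_one, pow_zero]
    ring
  have hpow : Filter.Tendsto (fun n : ℕ => 2 ^ n) Filter.atTop Filter.atTop :=
    tendsto_pow_atTop_atTop_of_one_lt one_lt_two
  obtain ⟨n, hn⟩ := ((hlim.comp hpow).eventually (gt_mem_nhds one_pos)).exists
  have hpos : 0 < (a / b) ^ 2 ^ n := by positivity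
  simp only [Function.comp_apply, Nat.cast_pow, Nat.cast_ofNat] at hn
  rw [div_lt_one hpos, div_pow, lt_div_iff₀ (by positivity)] at hn
  exact hn.not_ge (h n)

lemma norm_star_mul_self_pow_two_pow {F : Type w} [CStarAlgebra F] (z : F) (n : ℕ) :
    ‖(star z * z) ^ 2 ^ n‖ = (‖z‖ ^ 2) ^ 2 ^ n := by
  have := congrArg NNReal.toReal ((IsSelfAdjoint.star_mul_self z).nnnorm_pow_two_pow n)
  rwa [coe_nnnorm, NNReal.coe_pow, coe_nnnorm, CStarRing.norm_star_mul_self, ← sq] at this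

/-- On the `*`-algebra generated by a product pair the concrete norm dominates: apply the comparison
with constants to high powers of `x* x`, whose degrees grow only linearly. -/
lemma IsCovariantPair.norm_snd_le_norm_fst (h : IsCovariantPair α π W)
    {x : (PosSpace (HU α hα) →L[ℂ] PosSpace (HU α hα)) × (H →L[ℂ] H)}
    (hx : x ∈ StarAlgebra.adjoin ℂ
      (Set.range ((concreteRep α hα).prod π) ∪ {(concreteIsometry α hα, W)})) :
    ‖x.2‖ ≤ ‖x.1‖ := by
  obtain ⟨J, hJ⟩ := (h.concrete_prod hα).exists_mem_filtration hx
  have key : ∀ n : ℕ, ((‖x.2‖ ^ 2) ^ 2) ^ 2 ^ n ≤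
      ((4 * J : ℝ) * 2 ^ n + 1) * ((‖x.1‖ ^ 2) ^ 2) ^ 2 ^ n := by
    intro n
    have hmem := (h.concrete_prod hα).pow_mem_filtration
      ((h.concrete_prod hα).mul_mem_filtration ((h.concrete_prod hα).star_mem_filtration hJ) hJ)
      (2 ^ n)
    have := h.sq_norm_snd_le hmem
    rw [Prod.pow_snd, Prod.pow_fst, Prod.snd_mul, Prod.fst_mul, Prod.snd_star, Prod.fst_star,
      norm_star_mul_self_pow_two_pow, norm_star_mul_self_pow_two_pow] at this
    rw [pow_right_comm _ 2 (2 ^ n), pow_right_comm (‖x.1‖ ^ 2) 2 (2 ^ n)]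
    refine this.trans_eq ?_
    push_cast
    ring
  have h4 := le_of_forall_pow_le_linear_mul_pow (by positivity) (4 * J : ℝ) key
  rw [← pow_mul, ← pow_mul] at h4
  exact le_of_pow_le_pow_left₀ (by norm_num) (norm_nonneg _) h4

/-- The universal property: the closure of the `*`-algebra generated by the product of the concrete
pair and `(π, W)` is the graph of the required representation. -/
lemma IsCovariantPair.exists_extension (h : IsCovariantPair α π W) :
    ∃ π' : concreteAlgebra α hα →⋆ₐ[ℂ] (H →L[ℂ] H),
      (∀ a, π' (concreteIncl α hα a) = π a) ∧ π' (concreteElement α hα) = W := by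
  set S := StarAlgebra.adjoin ℂ
    (Set.range ((concreteRep α hα).prod π) ∪ {(concreteIsometry α hα, W)}) with hS
  set D := S.topologicalClosure with hD
  have : IsClosed (D : Set ((PosSpace (HU α hα) →L[ℂ] PosSpace (HU α hα)) × (H →L[ℂ] H))) :=
    StarSubalgebra.isClosed_topologicalClosure _
  have hle : ∀ d ∈ D, ‖d.2‖ ≤ ‖d.1‖ := fun d hd =>
    closure_minimal
      (t := {d : (PosSpace (HU α hα) →L[ℂ] PosSpace (HU α hα)) × (H →L[ℂ] H) | ‖d.2‖ ≤ ‖d.1‖})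
      (fun _ hx => h.norm_snd_le_norm_fst hx)
      (isClosed_le (by fun_prop) (by fun_prop)) hd
  let φ : D →⋆ₐ[ℂ] (PosSpace (HU α hα) →L[ℂ] PosSpace (HU α hα)) :=
    (StarAlgHom.fst ℂ _ _).comp D.subtype
  let ψ : D →⋆ₐ[ℂ] (H →L[ℂ] H) := (StarAlgHom.snd ℂ _ _).comp D.subtype
  have hφ : Function.Injective φ := by
    refine (injective_iff_map_eq_zero φ).mpr fun d hd => ?_
    have h1 : d.1.1 = 0 := hd
    have h2 := hle d.1 d.2
    rw [h1, norm_zero] at h2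
    exact Subtype.ext (Prod.ext h1 (norm_le_zero_iff.mp h2))
  have hmem : ∀ g ∈ Set.range ((concreteRep α hα).prod π) ∪ {(concreteIsometry α hα, W)},
      g ∈ D := fun g hg => StarSubalgebra.le_topologicalClosure _ (StarAlgebra.subset_adjoin ℂ _ hg)
  have hrange : concreteAlgebra α hα ≤ φ.range := by
    refine StarSubalgebra.topologicalClosure_minimal (StarAlgebra.adjoin_le ?_) ?_
    · rintro _ (⟨a, rfl⟩ | rfl)
      · exact ⟨⟨_, hmem _ (Or.inl ⟨a, rfl⟩)⟩, rfl⟩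
      · exact ⟨⟨_, hmem _ (Or.inr rfl)⟩, rfl⟩
    · exact (NonUnitalStarAlgHom.isometry φ hφ).isClosedEmbedding.isClosed_range
  let e := StarAlgEquiv.ofInjective φ hφ
  let π' : concreteAlgebra α hα →⋆ₐ[ℂ] (H →L[ℂ] H) :=
    (ψ.comp (e.symm : φ.range →⋆ₐ[ℂ] D)).comp (StarSubalgebra.inclusion hrange)
  have hπ' : ∀ (d : D) (hd : d.1.1 ∈ concreteAlgebra α hα), π' ⟨d.1.1, hd⟩ = d.1.2 := by
    intro d hd
    have : e.symm (StarSubalgebra.inclusion hrange ⟨d.1.1, hd⟩) = d :=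
      (congrArg e.symm (Subtype.ext rfl)).trans (e.symm_apply_apply d)
    exact congrArg (fun d : D => d.1.2) this
  exact ⟨π', fun a => hπ' ⟨_, hmem _ (Or.inl ⟨a, rfl⟩)⟩ (concreteRep_mem α hα a),
    hπ' ⟨_, hmem _ (Or.inr rfl)⟩ (concreteIsometry_mem α hα)⟩

end Representation

end CStarCrossedProduct

end

theorem theorem2 {A : Type u} [CStarAlgebra A] (α : A →⋆ₐ[ℂ] A)
    (hα : Function.Injective α) :
    IsCrossedProductN.{u, v, u} α (concreteAlgebra α hα) (concreteIncl α hα)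
        (concreteElement α hα) ∧
      (∀ ξ : PosSpace (HU α hα),
        posIncl (HU α hα) ((concreteElement α hα).1 ξ) =
          shift (HU α hα) (posProj (HU α hα) (posIncl (HU α hα) ξ))) ∧
      concreteAlgebra α hα =
        (StarAlgebra.adjoin ℂ (compress '' (crossedProductZ (limitAut α hα) :
          Set (L2Z (HU α hα) →L[ℂ] L2Z (HU α hα))))).topologicalClosure := by
  have h := isCovariantPair_concrete α hα
  refine ⟨?_, fun ξ => ?_, concreteAlgebra_eq_adjoin_compress α hα⟩
  · exact
      { injective := fun a b hab => concreteRep_injective α hα (congrArg Subtype.val hab)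
        isometry := Subtype.ext h.isometry
        generate := adjoin_concreteIncl_topologicalClosure α hα
        covariant := fun a => Subtype.ext (h.covariant a)
        commute := fun k a => Subtype.ext (h.commute k a)
        universal := fun H _ _ _ π W hW => hW.isCovariantPair.exists_extension }
  · rw [posProj_posIncl]
    exact posIncl_compress_shift ξ
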